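/- Let $V$ be a three-dimensional real inner product space and $\mathrm{Sym}$ the space of symmetric linear maps $V\to V$. Every $A\in\mathrm{Sym}$ has a spectral decomposition $A=\sum_{i=1}^d\alpha_iA_i$, $d\le 3$, with distinct real eigenvalues $\alpha_i$ and nonzero symmetric $A_i$ such that $A_iA_j=\delta_{ij}A_i$ and $\sum_i A_i=I$. For $f:\mathbb R\to\mathbb R$ put $f(A)=\sum_i f(\alpha_i)A_i$; the same rule defines $f$ on all of $\mathrm{Sym}$. Let $(B_0\boxtimes B_1\boxtimes\dots\boxtimes B_n):X_1\cdots X_n=B_0X_1B_1^tX_2B_2^t\cdots X_nB_n^t$. Let $n\ge 0$ be an integer and let $f$ be $n$ times continuously differentiable in a neighbourhood of each eigenvalue of $A$. Then $B\mapsto f(B)$ is $n$ times continuously differentiable near $A$ on $\mathrm{Sym}$, and its $n$-th derivative is $$\frac1{n!}\nabla^{(n)}f(A)=\sum_{i_1,\dots,i_{n+1}=1}^d f^{(n)}_{i_1\dots i_{n+1}}\,A_{i_1}\boxtimes\cdots\boxtimes A_{i_{n+1}},$$ in the sense that both sides have the same contraction with $X\cdots X$ ($n$ factors) for every $X\in\mathrm{Sym}$;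 equivalently, as a symmetric $n$-linear map, $$\nabla^{(n)}f(A)[X_1,\dots,X_n]=\sum_{\sigma\in S_n}\ \sum_{i_1,\dots,i_{n+1}=1}^d f^{(n)}_{i_1\dots i_{n+1}}\,A_{i_1}X_{\sigma(1)}A_{i_2}X_{\sigma(2)}\cdots X_{\sigma(n)}A_{i_{n+1}}.$$ The coefficients depend only on $n$, $f$ and $\alpha_1,\dots,\alpha_d$ and have the following properties. (1) They are unaltered under all permutations of the $n+1$ indices. (2) Let $\nu_l$ be the number of occurrences of the index $l$ in $(i_1,\dots,i_{n+1})$, so that $\sum_l\nu_l=n+1$. Then $$f^{(n)}_{i_1\dots i_{n+1}}=\sum_{l:\,\nu_l>0}\frac1{(\nu_l-1)!}\,\frac{d^{\nu_l-1}}{dx^{\nu_l-1}}\,\frac{f(x)}{\prod_{m\ne l}(x-\alpha_m)^{\nu_m}}\bigg|_{x=\alpha_l}.$$ (3) There is a unique polynomial $P(x)=p_nx^n+\dots+p_0$ of degree at most $n$ such that $P^{(I)}(\alpha_l)=f^{(I)}(\alpha_l)$ for all $l$ and all $0\le I\le\nu_l-1$, and $f^{(n)}_{i_1\dots i_{n+1}}=p_n$.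 (4) For $d=3$, regard each coefficient as a function of $f\in C^n(\mathbb R)$ and of the three distinct points $\alpha_1,\alpha_2,\alpha_3$. There are exactly $(n+2)(n+3)/2$ distinct coefficients. Count two of them as the same expression if they agree after a relabelling of the three points; this happens exactly when their multiplicity triples $(\nu_1,\nu_2,\nu_3)$ agree up to a permutation. The number of expressions is $\left\lfloor\frac{(n+4)^2+4}{12}\right\rfloor$. -/

import Mathlib

noncomputable section

namespace TensorFunction

section Tensors

variable (V : Type*) [NormedAddCommGroup V] [InnerProductSpace ℝ V] [CompleteSpace V]

/-- Second order tensors on `V`: linear maps `V → V`, with the operator norm. The transpose of `B`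
is its adjoint `star B`. -/
abbrev Lin : Type _ := V →L[ℝ] V

/-- Symmetric second order tensors, as a real normed space. -/
abbrev SymTensor : Type _ := selfAdjoint.submodule ℝ (V →L[ℝ] V)

variable {V}

/-- `A = ∑ α_i A_i` is the spectral decomposition of `A`: the `α_i` are the distinct eigenvalues,
and the `A_i` are nonzero symmetric tensors with `A_i A_j = δ_ij A_i` and `∑ A_i = I`. -/
structure IsSpectralDecomposition {d : ℕ} (A : SymTensor V) (α : Fin d → ℝ)
    (P : Fin d → SymTensor V) : Prop where
  injective : Function.Injective α
  ne_zero : ∀ i, P i ≠ 0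
  mul_eq : ∀ i j, (P i : Lin V) * (P j : Lin V) = if i = j then (P i : Lin V) else 0
  sum_eq_one : ∑ i, (P i : Lin V) = 1
  eq_sum : A = ∑ i, α i • P i

/-- The contraction `(B_0 ⊠ B_1 ⊠ … ⊠ B_n) : X_1 X_2 … X_n = B_0 X_1 B_1ᵗ X_2 B_2ᵗ … X_n B_nᵗ`. -/
def boxContract {n : ℕ} (B : Fin (n + 1) → Lin V) (X : Fin n → Lin V) : Lin V :=
  B 0 * (List.ofFn fun k : Fin n => X k * star (B k.succ)).prod

variable [FiniteDimensional ℝ V]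

/-- The orthogonal projection onto the eigenspace of `A` for `μ`, a symmetric tensor. -/
def eigenProj (A : SymTensor V) (μ : ℝ) : SymTensor V :=
  ⟨(Module.End.eigenspace ((A : Lin V) : V →ₗ[ℝ] V) μ).starProjection,
    isSelfAdjoint_starProjection _⟩

/-- The tensor function `f(A) = ∑ f(μ) A_μ`; the sum is over the distinct eigenvalues `μ` of `A`,
and `A_μ` is the orthogonal projection onto the eigenspace of `μ`. -/
def tensorFun (f : ℝ → ℝ) (A : SymTensor V) : SymTensor V :=
  ∑ μ : Module.End.Eigenvalues ((A : Lin V) : V →ₗ[ℝ] V), f μ • eigenProj A μ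

end Tensors

section Coefficients

/-- The number of occurrences `ν_l` of the index `l` in the multi-index `(i_1, …, i_{n+1})`. -/
def occurrences {n d : ℕ} (i : Fin (n + 1) → Fin d) (l : Fin d) : ℕ :=
  (Finset.univ.filter fun s => i s = l).card

/-- The residue formula
`∑_{l, ν_l > 0} 1/(ν_l - 1)! (d/dx)^{ν_l - 1} [f(x) / ∏_{m ≠ l} (x - α_m)^{ν_m}]` at `x = α_l`. -/
def residueCoeff {d : ℕ} (f : ℝ → ℝ) (α : Fin d → ℝ) (ν : Fin d → ℕ) : ℝ :=
  ∑ l ∈ Finset.univ.filter (fun l => 0 < ν l),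
    (1 / ((ν l - 1).factorial : ℝ)) *
      iteratedDeriv (ν l - 1) (fun x => f x / ∏ m ∈ Finset.univ.erase l, (x - α m) ^ ν m) (α l)

/-- `Q` fits the data `f^(I)(α_l)`, for all `l` and all `0 ≤ I ≤ ν_l - 1`. -/
def Interpolates {d : ℕ} (f : ℝ → ℝ) (α : Fin d → ℝ) (ν : Fin d → ℕ) (Q : Polynomial ℝ) : Prop :=
  ∀ l, ∀ I < ν l, (Polynomial.derivative^[I] Q).eval (α l) = iteratedDeriv I f (α l)

/-- Formulas that assign a number to a `C^n` function and three distinct points. -/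
abbrev Expression (n : ℕ) : Type :=
  {f : ℝ → ℝ // ContDiff ℝ n f} → {α : Fin 3 → ℝ // Function.Injective α} → ℝ

/-- The coefficient with multiplicities `ν`, as a function of `f` and of the three points. -/
def coeffExpression (n : ℕ) (ν : Fin 3 → ℕ) : Expression n :=
  fun f α => residueCoeff f.1 α.1 ν

/-- All coefficients of the `n`-th derivative for three distinct eigenvalues, as functions of `f` and
of the eigenvalues. -/
def coeffExpressions (n : ℕ) : Set (Expression n) :=
  Set.range fun i : Fin (n + 1) → Fin 3 => coeffExpression n (occurrences i)

/-- Two formulas are the same expression if they agree after relabelling the three points. -/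
def SameExpression {n : ℕ} (g h : Expression n) : Prop :=
  ∃ σ : Equiv.Perm (Fin 3), ∀ f α, h f α = g f ⟨α.1 ∘ σ, α.2.comp σ.injective⟩

end Coefficients

end TensorFunction

end

/-!
For a polynomial `p` and spectral projections `P_i` of `A`, the relation `P_i A = α_i P_i` gives
`P_i p(A + X) = p(α_i) P_i + P_i X q(A + X)`, where `q(x) = (p(x) - p(α_i)) / (x - α_i)`. Inserting
`1 = ∑ P_j` in front of `q(A + X)` and repeating yields the exact Taylor expansion of `p(A + X)`
(`proj_mul_aeval_add`). Its term of order `n` is the sum over multi-indices of the divided difference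
`p[α_{i_1}, …, α_{i_{n+1}}]` times `P_{i_1} X P_{i_2} ⋯ X P_{i_{n+1}}`; this gives the `n`-th
derivative of `p` as a tensor function (`iteratedFDeriv_aeval`). A divided difference of order `n` is
bounded by the supremum of `|p^(n)|` over an interval containing the nodes (`abs_dividedDiff_le`), and
the spectral projections have norm at most one, so the `n`-th derivative of `B ↦ p(B)` on a ball is
bounded by a multiple of `sup |p^(n)|` that does not depend on `p` (`norm_iteratedFDeriv_aeval_le`).

A function of class `C^n` on the line is, on a bounded interval, the limit in `C^n` of polynomials.
By the bound, the corresponding tensor functions are Cauchy in `C^n` on a ball, so their limit is of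
class `C^n` and its `n`-th derivative is the limit of the `n`-th derivatives
(`contDiffAt_symInclusion_tensorFun`). The coefficients converge as well, because the residue formula
is a fixed linear combination of the derivatives of `f` at the `α_l` (`exists_residueCoeff_eq_sum`).
A function that is `C^n` only near the eigenvalues of `A` agrees near them with a globally `C^n`
function, and near `A` the two tensor functions agree because eigenvalues depend continuously on the
tensor (`tensorFun_eventuallyEq`).

That the residue formula is the leading coefficient of the Hermite interpolation polynomial is the
theorem that the sum of the residues of `Q / ∏ (x - α_l)^ν_l` at its finite poles is the coefficient
of `1/x` at infinity (`residueCoeff_eval_eq_coeff`), proved by induction on `∑ ν_l`. For `f = p` a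
polynomial the leading coefficient is also the divided difference of `p`.

The coefficient of `f(x) = x^(n+1)` with multiplicities `ν` is `∑ ν_l α_l` (`residueCoeff_pow`).
Hence coefficients with different multiplicities differ as functions of `f` and the points, and
relabelling the points permutes the multiplicities. So the coefficients correspond to triples of
natural numbers with sum `n + 1`, and the expressions to partitions of `n + 1` into at most three
parts.
-/

noncomputable section

namespace TensorFunction

open Polynomial

/-! ### Divided differences of polynomials -/

/-- Newton's divided difference `p[x_0, …, x_n]`: divide successively by `X - x_0`, …, `X - x_{n-1}`,
discard the remainders, and evaluate the last quotient at `x_n`. Nodes may repeat. -/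
def dividedDiff : (n : ℕ) → ℝ[X] → (Fin (n + 1) → ℝ) → ℝ
  | 0, p, x => p.eval (x 0)
  | n + 1, p, x => dividedDiff n (p /ₘ (X - C (x 0))) (Fin.tail x)

theorem eq_mul_divByMonic_add_eval (p : ℝ[X]) (y : ℝ) :
    p = (X - C y) * (p /ₘ (X - C y)) + C (p.eval y) := by
  conv_lhs => rw [← modByMonic_add_div p (X - C y), modByMonic_X_sub_C_eq_C_eval]
  ring

theorem degree_prod_X_sub_C {n : ℕ} (x : Fin n → ℝ) :
    (∏ s, (X - C (x s)) : ℝ[X]).degree = n := by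
  rw [degree_prod]; simp

/-- Newton's divided difference is the coefficient of `x^n` in the interpolation polynomial; in
particular it does not depend on the order of the nodes. -/
theorem dividedDiff_eq_coeff_modByMonic {n : ℕ} (p : ℝ[X]) (x : Fin (n + 1) → ℝ) :
    dividedDiff n p x = (p %ₘ ∏ s, (X - C (x s))).coeff n := by
  induction n generalizing p with
  | zero => simp [dividedDiff, modByMonic_X_sub_C_eq_C_eval]
  | succ n ih =>
    rw [dividedDiff, ih, Fin.prod_univ_succ (fun s => X - C (x s))]
    set q := p /ₘ (X - C (x 0)) with hq
    have hmon : (∏ s, (X - C (Fin.tail x s))).Monic := monic_prod_of_monic _ _ fun _ _ =>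
      monic_X_sub_C _
    have hr := degree_modByMonic_lt q hmon
    rw [degree_prod_X_sub_C] at hr
    set r := q %ₘ ∏ s, (X - C (Fin.tail x s)) with hr'
    have hrn : r.natDegree ≤ n := by
      by_cases h0 : r = 0
      · simp [h0]
      · exact Nat.lt_succ_iff.1 ((natDegree_lt_iff_degree_lt h0).2 hr)
    have key := (div_modByMonic_unique (f := p) (g := (X - C (x 0)) * ∏ s, (X - C (Fin.tail x s)))
      (q /ₘ ∏ s, (X - C (Fin.tail x s))) ((X - C (x 0)) * r + C (p.eval (x 0)))
      ((monic_X_sub_C _).mul hmon) ⟨?_, ?_⟩).2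
    · change r.coeff n = (p %ₘ ((X - C (x 0)) * ∏ s, (X - C (Fin.tail x s)))).coeff (n + 1)
      rw [key]
      have h1 : r.coeff (n + 1) = 0 := coeff_eq_zero_of_natDegree_lt (by omega)
      simp [sub_mul, h1]
    · have h := modByMonic_add_div q (∏ s, (X - C (Fin.tail x s)))
      have hp := eq_mul_divByMonic_add_eval p (x 0)
      rw [← hq] at hp
      rw [← hr'] at h
      conv_rhs => rw [hp, ← h]
      ring
    · rw [degree_mul, degree_X_sub_C, degree_prod_X_sub_C]
      have hle : ((X - C (x 0)) * r + C (p.eval (x 0))).natDegree ≤ n + 1 := by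
        refine (natDegree_add_le _ _).trans (max_le (natDegree_mul_le.trans ?_) (by simp))
        rw [natDegree_X_sub_C]; omega
      refine (degree_le_of_natDegree_le hle).trans_lt ?_
      rw [add_comm (1 : WithBot ℕ)]
      exact_mod_cast Nat.lt_succ_self (n + 1)

theorem iterate_derivative_X_sub_C_mul' (q : ℝ[X]) (y : ℝ) (k : ℕ) :
    derivative^[k + 1] ((X - C y) * q) =
      (X - C y) * derivative^[k + 1] q + ((k + 1 : ℕ) : ℝ[X]) * derivative^[k] q := by
  induction k with
  | zero => simp [add_comm]
  | succ k ih =>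
    rw [Function.iterate_succ_apply', ih, Function.iterate_succ_apply' _ (k + 1),
      Function.iterate_succ_apply' _ k]
    simp only [derivative_add, derivative_mul, derivative_sub, derivative_X, derivative_C,
      derivative_natCast]
    push_cast
    ring

/-- A bound for `p^(k+1)` on an interval also bounds the `k`-th derivative of the difference quotient
`(p(x) - p(y)) / (x - y)`. -/
theorem abs_iterate_derivative_divByMonic_le {p : ℝ[X]} {a b M y : ℝ} {k : ℕ}
    (hp : ∀ x ∈ Set.Icc a b, |(derivative^[k + 1] p).eval x| ≤ M) (hy : y ∈ Set.Icc a b)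
    {x : ℝ} (hx : x ∈ Set.Icc a b) :
    |(derivative^[k] (p /ₘ (X - C y))).eval x| ≤ M := by
  set q := p /ₘ (X - C y) with hq
  have hM : 0 ≤ M := (abs_nonneg _).trans (hp x hx)
  have hder : derivative^[k + 1] p =
      (X - C y) * derivative^[k + 1] q + ((k + 1 : ℕ) : ℝ[X]) * derivative^[k] q := by
    rw [← iterate_derivative_X_sub_C_mul']
    conv_lhs => rw [eq_mul_divByMonic_add_eval p y]
    rw [iterate_map_add, iterate_derivative_C (Nat.succ_pos k), add_zero]
  rcases eq_or_ne x y with rfl | hxy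
  · have h := hp x hx
    rw [hder] at h
    simp only [eval_add, eval_mul, eval_sub, eval_X, eval_C, sub_self, zero_mul, zero_add,
      eval_natCast, abs_mul] at h
    refine le_trans ?_ h
    have : (1 : ℝ) ≤ |((k + 1 : ℕ) : ℝ)| := by
      rw [Nat.abs_cast]; exact_mod_cast Nat.le_add_left 1 k
    nlinarith [abs_nonneg ((derivative^[k] q).eval x)]
  -- `(x - y)^(k+1) q^(k)(x)` vanishes at `y` and has the derivative `(x - y)^k p^(k+1)(x)`.
  · have hseg : Set.uIcc y x ⊆ Set.Icc a b := Set.uIcc_subset_Icc hy hx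
    have hd : ∀ t ∈ Set.uIcc y x, HasDerivWithinAt
        (fun t => ((X - C y) ^ (k + 1) * derivative^[k] q).eval t)
        ((t - y) ^ k * (derivative^[k + 1] p).eval t) (Set.uIcc y x) t := by
      intro t _
      have h := (((X - C y) ^ (k + 1) * derivative^[k] q).hasDerivAt t).hasDerivWithinAt
        (s := Set.uIcc y x)
      have he : (t - y) ^ k * (derivative^[k + 1] p).eval t =
          (derivative ((X - C y) ^ (k + 1) * derivative^[k] q)).eval t := by
        rw [derivative_mul, derivative_pow, hder, Function.iterate_succ_apply' _ k]
        simp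
        ring
      rw [he]
      exact h
    have hb : ∀ t ∈ Set.uIcc y x,
        ‖(t - y) ^ k * (derivative^[k + 1] p).eval t‖ ≤ |x - y| ^ k * M := by
      intro t ht
      rw [norm_mul, norm_pow, Real.norm_eq_abs, Real.norm_eq_abs]
      have h1 : |t - y| ≤ |x - y| := Set.abs_sub_left_of_mem_uIcc ht
      exact mul_le_mul (pow_le_pow_left₀ (abs_nonneg _) h1 _) (hp t (hseg ht)) (abs_nonneg _)
        (by positivity)
    have h := (convex_uIcc y x).norm_image_sub_le_of_norm_hasDerivWithin_le hd hb
      Set.left_mem_uIcc Set.right_mem_uIcc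
    simp only [eval_mul, eval_pow, eval_sub, eval_X, eval_C, sub_self, ne_eq, Nat.succ_ne_zero,
      not_false_eq_true, zero_pow, zero_mul, sub_zero, norm_mul, norm_pow, Real.norm_eq_abs] at h
    have hpos : 0 < |x - y| ^ (k + 1) := pow_pos (abs_pos.2 (sub_ne_zero.2 hxy)) _
    refine le_of_mul_le_mul_left (h.trans (le_of_eq ?_)) hpos
    ring

theorem abs_dividedDiff_le {n : ℕ} {p : ℝ[X]} {a b M : ℝ} {x : Fin (n + 1) → ℝ}
    (hp : ∀ t ∈ Set.Icc a b, |(derivative^[n] p).eval t| ≤ M) (hx : ∀ s, x s ∈ Set.Icc a b) :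
    |dividedDiff n p x| ≤ M := by
  induction n generalizing p with
  | zero => simpa [dividedDiff] using hp _ (hx 0)
  | succ n ih =>
    exact ih (fun t ht => abs_iterate_derivative_divByMonic_le hp (hx 0) ht) fun s => hx s.succ

/-! ### The residue formula and Hermite interpolation -/

theorem contDiff_eval (p : ℝ[X]) {n : WithTop ℕ∞} : ContDiff ℝ n fun x => p.eval x := by
  simpa using p.contDiff_aeval (𝕜 := ℝ) n

theorem natDegree_le_iff_degree_lt_succ (p : ℝ[X]) (n : ℕ) :
    p.natDegree ≤ n ↔ p.degree < (n + 1 : ℕ) := by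
  rw [natDegree_le_iff_coeff_eq_zero, degree_lt_iff_coeff_zero]
  rfl

theorem iteratedDeriv_eval (p : ℝ[X]) (k : ℕ) :
    iteratedDeriv k (fun x => p.eval x) = fun x => (derivative^[k] p).eval x := by
  induction k with
  | zero => simp
  | succ k ih =>
    rw [iteratedDeriv_succ, ih, Function.iterate_succ_apply']
    ext x
    simp

theorem contDiffAt_prod_X_sub_pow {d : ℕ} (α : Fin d → ℝ) (ν : Fin d → ℕ) (s : Finset (Fin d))
    {n : WithTop ℕ∞} (x : ℝ) : ContDiffAt ℝ n (fun x => ∏ m ∈ s, (x - α m) ^ ν m) x :=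
  contDiffAt_prod fun _ _ => (contDiffAt_id.sub contDiffAt_const).pow _

theorem prod_erase_sub_pow_ne_zero {d : ℕ} {α : Fin d → ℝ} (hα : Function.Injective α)
    (ν : Fin d → ℕ) (l : Fin d) : ∏ m ∈ Finset.univ.erase l, (α l - α m) ^ ν m ≠ 0 := by
  refine Finset.prod_ne_zero_iff.2 fun m hm => pow_ne_zero _ (sub_ne_zero.2 fun h => ?_)
  exact Finset.ne_of_mem_erase hm (hα h).symm

/-- The residue formula is a linear combination, with weights that do not depend on `f`, of the
derivatives `f^(j)(α_l)`, `j < ν_l`. -/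
theorem exists_residueCoeff_eq_sum {d n : ℕ} {α : Fin d → ℝ} (hα : Function.Injective α)
    {ν : Fin d → ℕ} (hν : ∀ l, ν l ≤ n + 1) :
    ∃ w : Fin d → ℕ → ℝ, ∀ f : ℝ → ℝ, (∀ l, ContDiffAt ℝ n f (α l)) →
      residueCoeff f α ν = ∑ l, ∑ j ∈ Finset.range (ν l), w l j * iteratedDeriv j f (α l) := by
  refine ⟨fun l j => 1 / ((ν l - 1).factorial : ℝ) * ((ν l - 1).choose j *
    iteratedDeriv (ν l - 1 - j) (fun x => (∏ m ∈ Finset.univ.erase l, (x - α m) ^ ν m)⁻¹) (α l)),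
    fun f hf => ?_⟩
  rw [residueCoeff, Finset.sum_filter]
  refine Finset.sum_congr rfl fun l _ => ?_
  rcases Nat.eq_zero_or_pos (ν l) with h0 | hpos
  · simp [h0]
  have hle : ((ν l - 1 : ℕ) : WithTop ℕ∞) ≤ n := by
    have := hν l
    exact_mod_cast (by omega : ν l - 1 ≤ n)
  simp only [hpos, if_true, div_eq_mul_inv (f _)]
  rw [iteratedDeriv_fun_mul (g := fun x => (∏ m ∈ Finset.univ.erase l, (x - α m) ^ ν m)⁻¹)
    ((hf l).of_le hle)
    ((contDiffAt_prod_X_sub_pow α ν _ _).inv (prod_erase_sub_pow_ne_zero hα ν l)),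
    Nat.sub_add_cancel hpos, Finset.mul_sum]
  refine Finset.sum_congr rfl fun j _ => ?_
  ring

theorem residueCoeff_congr {d n : ℕ} {α : Fin d → ℝ} (hα : Function.Injective α)
    {ν : Fin d → ℕ} (hν : ∀ l, ν l ≤ n + 1) {f g : ℝ → ℝ} (hf : ∀ l, ContDiffAt ℝ n f (α l))
    (hg : ∀ l, ContDiffAt ℝ n g (α l))
    (h : ∀ l, ∀ j < ν l, iteratedDeriv j f (α l) = iteratedDeriv j g (α l)) :
    residueCoeff f α ν = residueCoeff g α ν := by
  obtain ⟨w, hw⟩ := exists_residueCoeff_eq_sum hα hν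
  rw [hw f hf, hw g hg]
  refine Finset.sum_congr rfl fun l _ => Finset.sum_congr rfl fun j hj => ?_
  rw [h l j (Finset.mem_range.1 hj)]

theorem residueCoeff_add_const_mul {d : ℕ} {α : Fin d → ℝ} (hα : Function.Injective α)
    (ν : Fin d → ℕ) (p q : ℝ[X]) (c : ℝ) :
    residueCoeff (fun x => c * p.eval x + q.eval x) α ν =
      c * residueCoeff (fun x => p.eval x) α ν + residueCoeff (fun x => q.eval x) α ν := by
  obtain ⟨w, hw⟩ := exists_residueCoeff_eq_sum (n := ∑ l, ν l) hα fun l =>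
    (Finset.single_le_sum (fun _ _ => Nat.zero_le _) (Finset.mem_univ l)).trans (Nat.le_succ _)
  have hC : ∀ (r : ℝ[X]) (l : Fin d) (k : ℕ), ContDiffAt ℝ k (fun x => r.eval x) (α l) :=
    fun r l k => (contDiff_eval r).contDiffAt
  have hfun : (fun x => c * p.eval x + q.eval x) = fun x => (C c * p + q).eval x := by
    ext x; simp
  rw [hfun, hw _ (fun l => hC (C c * p + q) l _), hw _ (fun l => hC _ l _), hw _ (fun l => hC _ l _),
    Finset.mul_sum, ← Finset.sum_add_distrib]
  refine Finset.sum_congr rfl fun l _ => ?_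
  rw [Finset.mul_sum, ← Finset.sum_add_distrib]
  refine Finset.sum_congr rfl fun j _ => ?_
  rw [iteratedDeriv_eval, iteratedDeriv_eval, iteratedDeriv_eval]
  simp only [iterate_map_add, iterate_derivative_C_mul, eval_add, eval_mul, eval_C]
  ring

theorem iteratedDeriv_sub_mul_self {a : ℝ} {h : ℝ → ℝ} {m : ℕ}
    (hh : ContDiffAt ℝ (m + 1 : ℕ) h a) :
    iteratedDeriv (m + 1) (fun x => (x - a) * h x) a = (m + 1) * iteratedDeriv m h a := by
  have h0 : ∀ k, iteratedDeriv (k + 2) (fun x : ℝ => x - a) a = 0 := fun k => by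
    have hd : deriv (fun x : ℝ => x - a) = fun _ => 1 := by ext; simp
    rw [iteratedDeriv_succ', iteratedDeriv_succ', hd]
    simp
  rw [iteratedDeriv_fun_mul (f := fun x => x - a) (contDiffAt_id.sub contDiffAt_const) hh,
    Finset.sum_range_succ', Finset.sum_range_succ']
  simp [h0, iteratedDeriv_one]

theorem iteratedDeriv_sub_pow_mul_self {a : ℝ} {h : ℝ → ℝ} (hh : ∀ n : ℕ, ContDiffAt ℝ n h a)
    {m k : ℕ} (hmk : m < k) : iteratedDeriv m (fun x => (x - a) ^ k * h x) a = 0 := by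
  induction m generalizing k with
  | zero => simp [(Nat.pos_of_ne_zero (Nat.ne_zero_of_lt hmk)).ne']
  | succ m ih =>
    obtain ⟨k, rfl⟩ := Nat.exists_eq_succ_of_ne_zero (Nat.ne_zero_of_lt hmk)
    have hs : (fun x => (x - a) ^ (k + 1) * h x) = fun x => (x - a) * ((x - a) ^ k * h x) := by
      ext x; ring
    rw [Nat.succ_eq_add_one, hs, iteratedDeriv_sub_mul_self, ih (by omega), mul_zero]
    exact ((contDiffAt_id.sub contDiffAt_const).pow _).mul (hh _)

open Filter Topology in
/-- A factor `x - α_k` of the numerator cancels one factor of the denominator. -/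
theorem residueCoeff_sub_mul {d : ℕ} {α : Fin d → ℝ} (hα : Function.Injective α)
    {ν ν' : Fin d → ℕ} {k : Fin d} (hk : ν k = ν' k + 1) (hν : ∀ l, l ≠ k → ν l = ν' l)
    (q : ℝ[X]) :
    residueCoeff (fun x => (x - α k) * q.eval x) α ν = residueCoeff (fun x => q.eval x) α ν' := by
  rw [residueCoeff, residueCoeff, Finset.sum_filter, Finset.sum_filter]
  refine Finset.sum_congr rfl fun l _ => ?_
  rcases eq_or_ne l k with rfl | hl
  · have hp : (fun x => ∏ m ∈ Finset.univ.erase l, (x - α m) ^ ν m) =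
        fun x => ∏ m ∈ Finset.univ.erase l, (x - α m) ^ ν' m := by
      ext x
      exact Finset.prod_congr rfl fun m hm => by rw [hν m (Finset.ne_of_mem_erase hm)]
    have hpx := fun x => congrFun hp x
    simp only [hpx, hk, mul_div_assoc, Nat.add_sub_cancel, Nat.succ_pos, if_true]
    obtain h0 | hpos := Nat.eq_zero_or_pos (ν' l)
    · simp [h0]
    · obtain ⟨j, hj⟩ := Nat.exists_eq_succ_of_ne_zero hpos.ne'
      simp only [hj, Nat.succ_eq_add_one, Nat.add_sub_cancel, Nat.succ_pos, if_true]
      rw [iteratedDeriv_sub_mul_self, Nat.factorial_succ]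
      · push_cast
        field_simp
      · exact (contDiff_eval q).contDiffAt.div (contDiffAt_prod_X_sub_pow α _ _ _)
          (prod_erase_sub_pow_ne_zero hα _ l)
  · rw [hν l hl]
    split_ifs with h0
    swap
    · rfl
    congr 1
    refine EventuallyEq.iteratedDeriv_eq _ ?_
    have hne : ∀ᶠ x in 𝓝 (α l), x - α k ≠ 0 :=
      (continuousAt_id.sub continuousAt_const).eventually_ne (sub_ne_zero.2 fun h => hl (hα h))
    filter_upwards [hne] with x hx
    have hkl : k ∈ Finset.univ.erase l := by simp [hl.symm]
    rw [← Finset.mul_prod_erase _ _ hkl, ← Finset.mul_prod_erase _ _ hkl, hk, pow_succ,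
      Finset.prod_congr rfl fun m hm => by rw [hν m (Finset.ne_of_mem_erase hm)],
      mul_comm _ (x - α k), mul_assoc, mul_div_mul_left _ _ hx]

open Filter Topology in
/-- For this numerator the quotient in the residue formula is `1 / (x - α_k)^ν_k`, whose only pole is
`α_k`. -/
theorem residueCoeff_prod_erase {d : ℕ} {α : Fin d → ℝ} (hα : Function.Injective α)
    {ν : Fin d → ℕ} {k : Fin d} (hk : 0 < ν k) :
    residueCoeff (fun x => ∏ m ∈ Finset.univ.erase k, (x - α m) ^ ν m) α ν =
      if ν k = 1 then 1 else 0 := by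
  rw [residueCoeff, Finset.sum_eq_single_of_mem k (by simp [hk])]
  · have he : (fun x => (∏ m ∈ Finset.univ.erase k, (x - α m) ^ ν m) /
        ∏ m ∈ Finset.univ.erase k, (x - α m) ^ ν m) =ᶠ[𝓝 (α k)] fun _ => 1 := by
      have := ((contDiffAt_prod_X_sub_pow (n := 0) α ν (Finset.univ.erase k)
        (α k)).continuousAt).eventually_ne (prod_erase_sub_pow_ne_zero hα ν k)
      filter_upwards [this] with x hx using div_self hx
    rw [he.iteratedDeriv_eq, iteratedDeriv_const]
    rcases eq_or_ne (ν k) 1 with h1 | h1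
    · simp [h1]
    · have : ν k - 1 ≠ 0 := by omega
      simp [h1, this]
  · intro l hl hlk
    have hpos : 0 < ν l := (Finset.mem_filter.1 hl).2
    have he : (fun x => (∏ m ∈ Finset.univ.erase k, (x - α m) ^ ν m) /
        ∏ m ∈ Finset.univ.erase l, (x - α m) ^ ν m) =ᶠ[𝓝 (α l)]
        fun x => (x - α l) ^ ν l * ((x - α k) ^ ν k)⁻¹ := by
      have := ((contDiffAt_prod_X_sub_pow (n := 0) α ν (Finset.univ.erase l)
        (α l)).continuousAt).eventually_ne (prod_erase_sub_pow_ne_zero hα ν l)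
      filter_upwards [this] with x hx
      have hkl : k ∈ Finset.univ.erase l := by simp [hlk.symm]
      have hlk' : l ∈ Finset.univ.erase k := by simp [hlk]
      rw [← Finset.mul_prod_erase _ _ hkl] at hx ⊢
      rw [← Finset.mul_prod_erase _ _ hlk', Finset.erase_right_comm, ← div_eq_mul_inv,
        mul_div_mul_right _ _ (right_ne_zero_of_mul hx)]
    rw [he.iteratedDeriv_eq, iteratedDeriv_sub_pow_mul_self _ (by omega), mul_zero]
    intro n
    refine ((contDiffAt_id.sub contDiffAt_const).pow _).inv (pow_ne_zero _ ?_)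
    exact sub_ne_zero.2 fun h => hlk (hα h)

/-- The sum of the residues of `Q / ∏ (x - α_l)^ν_l` at its finite poles is the coefficient of `1/x`
at infinity. -/
theorem residueCoeff_eval_eq_coeff {d N : ℕ} {α : Fin d → ℝ} (hα : Function.Injective α)
    {ν : Fin d → ℕ} (hν : ∑ l, ν l = N) {Q : ℝ[X]} (hQ : Q.degree < N) :
    residueCoeff (fun x => Q.eval x) α ν = Q.coeff (N - 1) := by
  induction N generalizing ν Q with
  | zero =>
    have hQ0 : Q = 0 := by
      by_contra h
      exact absurd hQ (not_lt.2 (zero_le_degree_iff.2 h))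
    have h0 : ∀ l, ν l = 0 := fun l => (Finset.sum_eq_zero_iff.1 hν) l (Finset.mem_univ l)
    simp [residueCoeff, h0, hQ0]
  | succ N ih =>
    obtain ⟨k, -, hk⟩ : ∃ k ∈ Finset.univ, ν k ≠ 0 := by
      by_contra! h
      rw [Finset.sum_eq_zero h] at hν
      omega
    have hpos : 0 < ν k := Nat.pos_of_ne_zero hk
    -- Split off a multiple of `R = ∏_{m ≠ k} (X - α_m)^ν_m`, so that the rest vanishes at `α_k`.
    set R : ℝ[X] := ∏ m ∈ Finset.univ.erase k, (X - C (α m)) ^ ν m with hR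
    have hReval : ∀ x, R.eval x = ∏ m ∈ Finset.univ.erase k, (x - α m) ^ ν m := fun x => by
      simp [hR, eval_prod]
    have hRne : R.eval (α k) ≠ 0 := by
      rw [hReval]; exact prod_erase_sub_pow_ne_zero hα ν k
    have hRmon : R.Monic := monic_prod_of_monic _ _ fun m _ => (monic_X_sub_C _).pow _
    have hsum : ν k + ∑ m ∈ Finset.univ.erase k, ν m = N + 1 := by
      rw [← hν, Finset.add_sum_erase _ _ (Finset.mem_univ k)]
    have hRdeg : R.natDegree = ∑ m ∈ Finset.univ.erase k, ν m := by
      rw [hR, natDegree_prod_of_monic _ _ fun m _ => (monic_X_sub_C _).pow _]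
      simp
    set c := Q.eval (α k) / R.eval (α k) with hc
    set q := (Q - C c * R) /ₘ (X - C (α k)) with hq
    have hdec : Q = C c * R + (X - C (α k)) * q := by
      have := eq_mul_divByMonic_add_eval (Q - C c * R) (α k)
      have h0 : (Q - C c * R).eval (α k) = 0 := by
        simp [hc, hRne]
      rw [h0, C_0, add_zero] at this
      rw [hq, ← this]; ring
    have hqdeg : q.degree < N := by
      by_contra hle
      have h1 : ((X - C (α k)) * q : ℝ[X]).degree < (N + 1 : ℕ) := by
        have : (X - C (α k)) * q = Q - C c * R := by rw [hdec]; ring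
        rw [this]
        refine (degree_sub_le _ _).trans_lt (max_lt hQ ?_)
        rw [← smul_eq_C_mul]
        refine (degree_smul_le _ _).trans_lt (degree_le_natDegree.trans_lt ?_)
        exact_mod_cast (by omega : R.natDegree < N + 1)
      rw [degree_mul, degree_X_sub_C] at h1
      push Not at hle
      have h2 := (add_le_add_right hle (1 : WithBot ℕ)).trans_lt h1
      have h3 : ((1 + N : ℕ) : WithBot ℕ) < (N + 1 : ℕ) := by exact_mod_cast h2
      have := Nat.cast_lt.1 h3
      omega
    set ν' : Fin d → ℕ := Function.update ν k (ν k - 1) with hν'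
    have hν'k : ν' k = ν k - 1 := by simp [hν']
    have hν'l : ∀ l, l ≠ k → ν l = ν' l := fun l hl => by simp [hν', hl]
    have hν'sum : ∑ l, ν' l = N := by
      have : ∑ m ∈ Finset.univ.erase k, ν m = ∑ m ∈ Finset.univ.erase k, ν' m :=
        Finset.sum_congr rfl fun m hm => hν'l m (Finset.ne_of_mem_erase hm)
      rw [← Finset.add_sum_erase _ _ (Finset.mem_univ k), hν'k, ← this]
      omega
    have hfun : (fun x => Q.eval x) =
        fun x => c * R.eval x + ((X - C (α k)) * q).eval x := by
      ext x
      conv_lhs => rw [hdec]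
      simp
    rw [hfun, residueCoeff_add_const_mul hα]
    have h1 := residueCoeff_prod_erase hα hpos
    have h2 := residueCoeff_sub_mul hα (ν := ν) (ν' := ν') (k := k) (by omega) hν'l q
    simp only [hReval]
    simp only [eval_mul, eval_sub, eval_X, eval_C]
    rw [h1, h2, ih hν'sum hqdeg]
    have hRc : R.coeff N = if ν k = 1 then 1 else 0 := by
      split_ifs with h
      · have : R.natDegree = N := by omega
        rw [← this]; exact hRmon
      · exact coeff_eq_zero_of_natDegree_lt (by omega)
    conv_rhs => rw [hdec]
    have hqN : q.coeff N = 0 := coeff_eq_zero_of_degree_lt hqdeg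
    rw [Nat.add_sub_cancel, coeff_add, coeff_C_mul, hRc, sub_mul, coeff_sub, coeff_C_mul, hqN]
    rcases N with _ | N
    · have : q = 0 := by
        by_contra h
        exact absurd hqdeg (not_lt.2 (zero_le_degree_iff.2 h))
      simp [this]
    · simp

theorem prod_X_sub_C_pow_dvd {d : ℕ} {α : Fin d → ℝ} (hα : Function.Injective α)
    {ν : Fin d → ℕ} {Q : ℝ[X]} (h : ∀ l, ∀ I < ν l, (derivative^[I] Q).eval (α l) = 0) :
    ∏ l, (X - C (α l)) ^ ν l ∣ Q := by
  refine Finset.prod_dvd_of_coprime (fun l _ m _ hlm => ?_) fun l _ => ?_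
  · exact (pairwise_coprime_X_sub_C hα hlm).pow
  · rcases eq_or_ne Q 0 with rfl | hQ
    · simp
    rw [← le_rootMultiplicity_iff hQ]
    rcases Nat.eq_zero_or_pos (ν l) with h0 | hpos
    · simp [h0]
    · have := lt_rootMultiplicity_of_isRoot_iterate_derivative (n := ν l - 1) (t := α l) hQ
        fun m hm => h l m (by omega)
      omega

theorem eval_iterate_derivative_of_dvd {d : ℕ} {α : Fin d → ℝ} {ν : Fin d → ℕ} {Q : ℝ[X]}
    (h : ∏ l, (X - C (α l)) ^ ν l ∣ Q) (l : Fin d) {I : ℕ} (hI : I < ν l) :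
    (derivative^[I] Q).eval (α l) = 0 := by
  have h1 := pow_sub_dvd_iterate_derivative_of_pow_dvd I
    ((Finset.dvd_prod_of_mem _ (Finset.mem_univ l)).trans h)
  exact dvd_iff_isRoot.1 ((dvd_pow_self _ (by omega)).trans h1)

theorem degree_prod_X_sub_C_pow {d : ℕ} (α : Fin d → ℝ) (ν : Fin d → ℕ) :
    (∏ l, (X - C (α l)) ^ ν l : ℝ[X]).degree = (∑ l, ν l : ℕ) := by
  rw [degree_prod]
  simp

theorem eq_zero_of_jets_eq_zero {d n : ℕ} {α : Fin d → ℝ} (hα : Function.Injective α)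
    {ν : Fin d → ℕ} (hν : ∑ l, ν l = n + 1) {Q : ℝ[X]} (hQ : Q.degree < (n + 1 : ℕ))
    (h : ∀ l, ∀ I < ν l, (derivative^[I] Q).eval (α l) = 0) : Q = 0 := by
  refine eq_zero_of_dvd_of_degree_lt (prod_X_sub_C_pow_dvd hα h) ?_
  rwa [degree_prod_X_sub_C_pow, hν]

/-- Hermite interpolation: the jets of order `ν_l` at the points `α_l` are the values of an injective
linear map on polynomials of degree at most `n`, between spaces of the same dimension. -/
theorem existsUnique_interpolates {d n : ℕ} {α : Fin d → ℝ} (hα : Function.Injective α)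
    {ν : Fin d → ℕ} (hν : ∑ l, ν l = n + 1) (f : ℝ → ℝ) :
    ∃! Q : ℝ[X], Q.natDegree ≤ n ∧ Interpolates f α ν Q := by
  let T : degreeLT ℝ (n + 1) →ₗ[ℝ] ((l : Fin d) → Fin (ν l) → ℝ) :=
    { toFun := fun Q l I => (derivative^[(I : ℕ)] Q.1).eval (α l)
      map_add' := fun P Q => by ext l I; simp [iterate_map_add]
      map_smul' := fun c Q => by ext l I; simp [iterate_derivative_smul] }
  have hinj : Function.Injective T := by
    rw [← LinearMap.ker_eq_bot, LinearMap.ker_eq_bot']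
    intro Q hQ
    refine Subtype.ext (eq_zero_of_jets_eq_zero hα hν (mem_degreeLT.1 Q.2) fun l I hI => ?_)
    exact congrFun (congrFun hQ l) ⟨I, hI⟩
  have hfin : Module.finrank ℝ (degreeLT ℝ (n + 1)) =
      Module.finrank ℝ ((l : Fin d) → Fin (ν l) → ℝ) := by
    rw [LinearEquiv.finrank_eq (degreeLTEquiv ℝ (n + 1))]
    simp [Module.finrank_pi_fintype, hν]
  have : FiniteDimensional ℝ (degreeLT ℝ (n + 1)) :=
    (degreeLTEquiv ℝ (n + 1)).symm.finiteDimensional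
  obtain ⟨Q, hQ⟩ := (LinearMap.injective_iff_surjective_of_finrank_eq_finrank hfin).1 hinj
    fun l I => iteratedDeriv I f (α l)
  refine ⟨Q.1, ⟨(natDegree_le_iff_degree_lt_succ _ _).2 (mem_degreeLT.1 Q.2), fun l I hI =>
    congrFun (congrFun hQ l) ⟨I, hI⟩⟩, ?_⟩
  rintro R ⟨hR, hR'⟩
  have := hinj (a₁ := ⟨R, mem_degreeLT.2 ((natDegree_le_iff_degree_lt_succ _ _).1 hR)⟩) (a₂ := Q) (by
    rw [hQ]
    ext l I
    exact hR' l I I.2)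
  exact congrArg Subtype.val this

theorem residueCoeff_eq_coeff_of_interpolates {d n : ℕ} {α : Fin d → ℝ}
    (hα : Function.Injective α) {ν : Fin d → ℕ} (hν : ∑ l, ν l = n + 1) {f : ℝ → ℝ}
    (hf : ∀ l, ContDiffAt ℝ n f (α l)) {Q : ℝ[X]} (hQ : Q.natDegree ≤ n)
    (hQf : Interpolates f α ν Q) : residueCoeff f α ν = Q.coeff n := by
  have hle : ∀ l, ν l ≤ n + 1 := fun l =>
    hν ▸ Finset.single_le_sum (fun _ _ => Nat.zero_le _) (Finset.mem_univ l)
  rw [residueCoeff_congr hα hle (g := fun x => Q.eval x) hf (fun l => (contDiff_eval Q).contDiffAt),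
    residueCoeff_eval_eq_coeff hα hν, Nat.add_sub_cancel]
  · exact (natDegree_le_iff_degree_lt_succ _ _).1 hQ
  · intro l j hj
    rw [iteratedDeriv_eval, ← hQf l j hj]

theorem sum_occurrences {n d : ℕ} (i : Fin (n + 1) → Fin d) : ∑ l, occurrences i l = n + 1 := by
  have := Finset.card_eq_sum_card_fiberwise (f := i) (s := Finset.univ) (t := Finset.univ)
    fun _ _ => Finset.mem_coe.2 (Finset.mem_univ _)
  simpa [occurrences] using this.symm

theorem occurrences_comp_perm {n d : ℕ} (σ : Equiv.Perm (Fin (n + 1))) (i : Fin (n + 1) → Fin d) :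
    occurrences (i ∘ σ) = occurrences i := by
  ext l
  simp only [occurrences]
  refine Finset.card_bij (fun s _ => σ s) (fun s hs => by simpa using hs)
    (fun _ _ _ _ h => σ.injective h) fun s hs => ⟨σ.symm s, by simpa using hs, by simp⟩

theorem prod_comp_eq_prod_pow_occurrences {n d : ℕ} (i : Fin (n + 1) → Fin d) (α : Fin d → ℝ) :
    ∏ s, (X - C (α (i s))) = ∏ l, (X - C (α l)) ^ occurrences i l := by
  rw [← Finset.prod_fiberwise Finset.univ i]
  refine Finset.prod_congr rfl fun l _ => ?_
  rw [occurrences, ← Finset.prod_const]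
  exact Finset.prod_congr rfl fun s hs => by rw [(Finset.mem_filter.1 hs).2]

/-- For polynomials, the residue formula is a divided difference. -/
theorem residueCoeff_eval_eq_dividedDiff {n d : ℕ} {α : Fin d → ℝ} (hα : Function.Injective α)
    (p : ℝ[X]) (i : Fin (n + 1) → Fin d) :
    residueCoeff (fun x => p.eval x) α (occurrences i) = dividedDiff n p (α ∘ i) := by
  rw [dividedDiff_eq_coeff_modByMonic]
  simp only [Function.comp_apply]
  have hprod := prod_comp_eq_prod_pow_occurrences i α
  refine residueCoeff_eq_coeff_of_interpolates hα (sum_occurrences i)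
    (fun l => (contDiff_eval p).contDiffAt) ?_ fun l I hI => ?_
  · have := degree_modByMonic_lt p
      (monic_prod_of_monic Finset.univ _ fun s _ => monic_X_sub_C (α (i s)))
    rw [degree_prod_X_sub_C fun s => α (i s)] at this
    exact (natDegree_le_iff_degree_lt_succ _ _).2 this
  · rw [iteratedDeriv_eval, ← sub_eq_zero, ← eval_sub, ← iterate_map_sub]
    refine eval_iterate_derivative_of_dvd ?_ l hI
    rw [← hprod]
    exact dvd_modByMonic_sub _ _

/-! ### The Taylor expansion of a polynomial of a tensor -/

section Expansion

variable {V : Type*} [NormedAddCommGroup V] [InnerProductSpace ℝ V] [CompleteSpace V]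

theorem boxContract_zero (P : Fin 1 → Lin V) (X : Fin 0 → Lin V) : boxContract P X = P 0 := by
  simp [boxContract]

theorem boxContract_succ {n : ℕ} {P : Fin (n + 2) → Lin V} (hP : star (P 1) = P 1)
    (X : Fin (n + 1) → Lin V) :
    boxContract P X = P 0 * X 0 * boxContract (Fin.tail P) (Fin.tail X) := by
  simp only [boxContract, List.ofFn_succ, List.prod_cons, Fin.tail, Fin.succ_zero_eq_one, hP,
    mul_assoc]

theorem norm_boxContract_le {n : ℕ} {P : Fin (n + 1) → Lin V} (hP : ∀ s, star (P s) = P s)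
    (hP1 : ∀ s, ‖P s‖ ≤ 1) (X : Fin n → Lin V) : ‖boxContract P X‖ ≤ ∏ k, ‖X k‖ := by
  induction n with
  | zero => simpa [boxContract_zero] using hP1 0
  | succ n ih =>
    rw [boxContract_succ (hP 1), Fin.prod_univ_succ]
    refine (norm_mul_le _ _).trans (mul_le_mul ?_ (ih (fun s => hP s.succ) (fun s => hP1 s.succ) _)
      (norm_nonneg _) (norm_nonneg _))
    refine (norm_mul_le _ _).trans ?_
    nlinarith [hP1 0, norm_nonneg (X 0)]

theorem boxContract_cons {ι : Type*} {P : ι → Lin V} (hP : ∀ i, star (P i) = P i) {n : ℕ} (i : ι)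
    (w : Fin (n + 1) → ι) (Y : Lin V) :
    boxContract (P ∘ (Fin.cons i w : Fin (n + 2) → ι)) (fun _ => Y) =
      P i * Y * boxContract (P ∘ w) fun _ => Y := by
  have h : ∀ s, star ((P ∘ (Fin.cons i w : Fin (n + 2) → ι)) s) =
      (P ∘ (Fin.cons i w : Fin (n + 2) → ι)) s := fun s => hP _
  rw [boxContract_succ (h 1)]
  rfl

theorem dividedDiff_cons {ι : Type*} {n : ℕ} (p : ℝ[X]) (ev : ι → ℝ) (i : ι)
    (w : Fin (n + 1) → ι) :
    dividedDiff (n + 1) p (ev ∘ (Fin.cons i w : Fin (n + 2) → ι)) =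
      dividedDiff n (p /ₘ (X - C (ev i))) (ev ∘ w) := rfl

theorem dividedDiff_eq_zero {n : ℕ} {p : ℝ[X]} (hp : p.natDegree < n) (x : Fin (n + 1) → ℝ) :
    dividedDiff n p x = 0 := by
  have hmon : (∏ s, (X - C (x s))).Monic := monic_prod_of_monic _ _ fun _ _ => monic_X_sub_C _
  rw [dividedDiff_eq_coeff_modByMonic, (modByMonic_eq_self_iff hmon).2,
    coeff_eq_zero_of_natDegree_lt hp]
  rw [degree_prod_X_sub_C]
  exact degree_le_natDegree.trans_lt (by exact_mod_cast hp.trans (Nat.lt_succ_self n))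

variable {ι : Type*} [Fintype ι] {ev : ι → ℝ} {P : ι → Lin V}

omit [CompleteSpace V] [Fintype ι] in
theorem proj_mul_aeval_add_eq {b : Lin V} {i : ι} (hPB : P i * b = ev i • P i) (Y : Lin V)
    (p : ℝ[X]) : P i * aeval (b + Y) p =
      p.eval (ev i) • P i + P i * Y * aeval (b + Y) (p /ₘ (X - C (ev i))) := by
  conv_lhs => rw [eq_mul_divByMonic_add_eval p (ev i)]
  have hc : P i * (b + Y - algebraMap ℝ (Lin V) (ev i)) = P i * Y := by
    rw [mul_sub, mul_add, hPB, ← Algebra.commutes, ← Algebra.smul_def]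
    abel
  simp only [map_add, map_mul, map_sub, aeval_X, aeval_C, mul_add, ← mul_assoc]
  rw [hc, ← Algebra.commutes, ← Algebra.smul_def, add_comm]

/-- The recursion behind the expansion: with `p(x) = (x - λ_i) q(x) + p(λ_i)` one has
`P_i p(b + Y) = p(λ_i) P_i + P_i Y q(b + Y)`, because `P_i (b - λ_i) = 0`; then insert `∑ P_j = 1`
in front of `q(b + Y)` and repeat. -/
theorem proj_mul_aeval_add {b : Lin V} (hP : ∀ i, star (P i) = P i)
    (hPB : ∀ i, P i * b = ev i • P i) (h1 : ∑ i, P i = 1) (Y : Lin V) {N : ℕ} {p : ℝ[X]}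
    (hp : p.natDegree < N) (i : ι) :
    P i * aeval (b + Y) p =
      ∑ n ∈ Finset.range N, ∑ w : Fin n → ι,
        dividedDiff n p (ev ∘ (Fin.cons i w : Fin (n + 1) → ι)) •
          boxContract (P ∘ (Fin.cons i w : Fin (n + 1) → ι)) fun _ => Y := by
  induction N generalizing p i with
  | zero => omega
  | succ N ih =>
    set q := p /ₘ (X - C (ev i)) with hq
    have hexp : ∀ j, P i * Y * (P j * aeval (b + Y) q) =
        ∑ n ∈ Finset.range N, ∑ w : Fin n → ι,
          dividedDiff (n + 1) p (ev ∘ (Fin.cons i (Fin.cons j w : Fin (n + 1) → ι) :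
            Fin (n + 2) → ι)) •
          boxContract (P ∘ (Fin.cons i (Fin.cons j w : Fin (n + 1) → ι) : Fin (n + 2) → ι))
            fun _ => Y := by
      intro j
      rcases Nat.eq_zero_or_pos N with rfl | hN
      · have h0 : q = 0 := by
          rw [hq, divByMonic_eq_zero_iff (monic_X_sub_C _), degree_X_sub_C]
          exact degree_le_natDegree.trans_lt (by exact_mod_cast hp)
        rw [h0, map_zero, mul_zero, mul_zero, Finset.range_zero, Finset.sum_empty]
      have hqN : q.natDegree < N := by
        rw [hq, natDegree_divByMonic _ (monic_X_sub_C _), natDegree_X_sub_C]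
        omega
      rw [ih hqN, Finset.mul_sum]
      refine Finset.sum_congr rfl fun n _ => ?_
      rw [Finset.mul_sum]
      refine Finset.sum_congr rfl fun w _ => ?_
      rw [mul_smul_comm, boxContract_cons hP, dividedDiff_cons]
    have hsum : P i * Y * aeval (b + Y) q = ∑ j, P i * Y * (P j * aeval (b + Y) q) := by
      rw [← Finset.mul_sum, ← Finset.sum_mul, h1, one_mul]
    rw [proj_mul_aeval_add_eq (hPB i), hsum, Finset.sum_range_succ',
      Finset.sum_congr rfl fun j _ => hexp j, Finset.sum_comm, add_comm]
    congr 1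
    · refine Finset.sum_congr rfl fun n _ => ?_
      rw [← (Fin.consEquiv fun _ : Fin (n + 1) => ι).sum_comp, Fintype.sum_prod_type]
      rfl
    · simp [boxContract_zero, dividedDiff]

variable {E : Type*} [NormedAddCommGroup E] [NormedSpace ℝ E] (L : E →L[ℝ] Lin V) {B : E}

/-- `boxContract` as a continuous multilinear map. The vectors come from a normed space `E` mapped
to the tensors by `L`; below this is the inclusion of the symmetric tensors. -/
def boxMap {n : ℕ} (P : Fin (n + 1) → Lin V) :
    ContinuousMultilinearMap ℝ (fun _ : Fin n => E) (Lin V) :=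
  (ContinuousLinearMap.mul ℝ (Lin V) (P 0)).compContinuousMultilinearMap
    ((ContinuousMultilinearMap.mkPiAlgebraFin ℝ n (Lin V)).compContinuousLinearMap fun k =>
      ((ContinuousLinearMap.mul ℝ (Lin V)).flip (star (P k.succ))).comp L)

theorem boxMap_apply {n : ℕ} (P : Fin (n + 1) → Lin V) (X : Fin n → E) :
    boxMap L P X = boxContract P fun k => L (X k) := rfl

/-- The Taylor series at `B` of a polynomial of `L B`, written with the spectral projections `P_i`
of `L B`. -/
def taylorSeries (p : ℝ[X]) (ev : ι → ℝ) (P : ι → Lin V) :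
    FormalMultilinearSeries ℝ E (Lin V) := fun n =>
  ∑ w : Fin (n + 1) → ι, dividedDiff n p (ev ∘ w) • boxMap L (P ∘ w)

theorem taylorSeries_apply (p : ℝ[X]) {n : ℕ} (X : Fin n → E) :
    taylorSeries L p ev P n X =
      ∑ w : Fin (n + 1) → ι, dividedDiff n p (ev ∘ w) • boxContract (P ∘ w) fun k => L (X k) := by
  simp [taylorSeries, boxMap_apply]

theorem hasFPowerSeriesOnBall_aeval (hP : ∀ i, star (P i) = P i)
    (hPB : ∀ i, P i * L B = ev i • P i) (h1 : ∑ i, P i = 1) (p : ℝ[X]) :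
    HasFPowerSeriesOnBall (fun B => aeval (L B) p) (taylorSeries L p ev P) B ⊤ := by
  refine (HasFiniteFPowerSeriesOnBall.mk' (n := p.natDegree + 1) (fun n hn => ?_)
    ENNReal.zero_lt_top fun Y _ => ?_).toHasFPowerSeriesOnBall
  · refine ContinuousMultilinearMap.ext fun X => ?_
    rw [taylorSeries_apply]
    refine Finset.sum_eq_zero fun w _ => ?_
    rw [dividedDiff_eq_zero (by omega), zero_smul]
  · have h : aeval (L B + L Y) p = ∑ i, P i * aeval (L B + L Y) p := by
      rw [← Finset.sum_mul, h1, one_mul]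
    rw [map_add, h, Finset.sum_congr rfl fun i _ =>
      proj_mul_aeval_add hP hPB h1 (L Y) (Nat.lt_succ_self _) i, Finset.sum_comm]
    refine Finset.sum_congr rfl fun n _ => ?_
    rw [taylorSeries_apply, ← (Fin.consEquiv fun _ : Fin (n + 1) => ι).sum_comp,
      Fintype.sum_prod_type]
    rfl

theorem iteratedFDeriv_aeval (hP : ∀ i, star (P i) = P i)
    (hPB : ∀ i, P i * L B = ev i • P i) (h1 : ∑ i, P i = 1) (p : ℝ[X]) {n : ℕ} (X : Fin n → E) :
    iteratedFDeriv ℝ n (fun B => aeval (L B) p) B X =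
      ∑ σ : Equiv.Perm (Fin n), ∑ w : Fin (n + 1) → ι,
        dividedDiff n p (ev ∘ w) • boxContract (P ∘ w) fun k => L (X (σ k)) := by
  refine ((hasFPowerSeriesOnBall_aeval L hP hPB h1
    p).iteratedFDeriv_eq_sum_of_completeSpace X).trans ?_
  exact Finset.sum_congr rfl fun σ _ => taylorSeries_apply L p _

omit [CompleteSpace V] in
theorem contDiff_aeval_comp (p : ℝ[X]) {n : WithTop ℕ∞} :
    ContDiff ℝ n fun B => aeval (L B) p := by
  simp only [aeval_eq_sum_range]
  exact ContDiff.sum fun k _ => (L.contDiff.pow k).const_smul (p.coeff k)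

theorem norm_iteratedFDeriv_aeval_apply_le (hP : ∀ i, star (P i) = P i)
    (hP1 : ∀ i, ‖P i‖ ≤ 1) (hPB : ∀ i, P i * L B = ev i • P i) (h1 : ∑ i, P i = 1)
    {p : ℝ[X]} {n N : ℕ} (hN : Fintype.card ι ≤ N) {a b M : ℝ} (hM : 0 ≤ M)
    (hev : ∀ i, ev i ∈ Set.Icc a b)
    (hp : ∀ t ∈ Set.Icc a b, |(derivative^[n] p).eval t| ≤ M) (X : Fin n → E) :
    ‖iteratedFDeriv ℝ n (fun B => aeval (L B) p) B X‖ ≤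
      n.factorial * ((N : ℝ) ^ (n + 1) * M) * ∏ k, ‖L (X k)‖ := by
  rw [iteratedFDeriv_aeval L hP hPB h1]
  have hterm : ∀ (σ : Equiv.Perm (Fin n)) (w : Fin (n + 1) → ι),
      ‖dividedDiff n p (ev ∘ w) • boxContract (P ∘ w) fun k => L (X (σ k))‖ ≤
        M * ∏ k, ‖L (X k)‖ := by
    intro σ w
    rw [norm_smul, Real.norm_eq_abs]
    refine mul_le_mul (abs_dividedDiff_le hp fun s => hev _) ?_ (norm_nonneg _) hM
    refine (norm_boxContract_le (fun s => hP _) (fun s => hP1 _) _).trans (le_of_eq ?_)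
    exact Equiv.prod_comp σ fun k => ‖L (X k)‖
  refine (norm_sum_le_of_le _ fun σ _ => norm_sum_le_of_le _ fun w _ => hterm σ w).trans ?_
  calc _ = n.factorial * ((Fintype.card ι : ℝ) ^ (n + 1) * M) * ∏ k, ‖L (X k)‖ := by
        simp [Fintype.card_perm]
        ring
    _ ≤ _ := by gcongr

end Expansion

/-! ### The spectral decomposition of a symmetric tensor -/

section Spectral

variable {V : Type*} [NormedAddCommGroup V] [InnerProductSpace ℝ V] [CompleteSpace V]

theorem IsSpectralDecomposition.proj_mul {d : ℕ} {A : SymTensor V} {α : Fin d → ℝ}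
    {P : Fin d → SymTensor V} (h : IsSpectralDecomposition A α P) (i : Fin d) :
    (P i : Lin V) * (A : Lin V) = α i • (P i : Lin V) := by
  have hA : (A : Lin V) = ∑ j, α j • (P j : Lin V) := by
    conv_lhs => rw [h.eq_sum]
    simp
  rw [hA, Finset.mul_sum, Finset.sum_eq_single_of_mem i (Finset.mem_univ i)]
  · rw [mul_smul_comm, h.mul_eq, if_pos rfl]
  · intro j _ hji
    rw [mul_smul_comm, h.mul_eq, if_neg hji.symm, smul_zero]

theorem star_coe_symTensor (P : SymTensor V) : star (P : Lin V) = P := P.2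

theorem isSymmetric_coe (B : SymTensor V) : ((B : Lin V) : V →ₗ[ℝ] V).IsSymmetric :=
  ContinuousLinearMap.isSelfAdjoint_iff_isSymmetric.1 B.2

theorem norm_eigenProj_le (B : SymTensor V) (μ : ℝ) : ‖(eigenProj B μ : Lin V)‖ ≤ 1 :=
  Submodule.starProjection_norm_le _

theorem eigenProj_mul (B : SymTensor V) (μ : ℝ) :
    (eigenProj B μ : Lin V) * (B : Lin V) = μ • (eigenProj B μ : Lin V) := by
  have h : (B : Lin V) * (eigenProj B μ : Lin V) = μ • (eigenProj B μ : Lin V) := by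
    ext v
    exact Module.End.mem_eigenspace_iff.1
      (Submodule.starProjection_apply_mem
        (Module.End.eigenspace ((B : Lin V) : V →ₗ[ℝ] V) μ) v)
  have h' := congrArg star h
  rwa [star_mul, star_smul, star_coe_symTensor, star_coe_symTensor, star_trivial] at h'

/-- The inclusion of the symmetric tensors into all tensors. -/
def symInclusion : SymTensor V →L[ℝ] Lin V :=
  (selfAdjoint.submodule ℝ (V →L[ℝ] V)).subtypeL

theorem symInclusion_apply (B : SymTensor V) : symInclusion B = (B : Lin V) := rfl

variable [FiniteDimensional ℝ V]

theorem sum_eigenProj (B : SymTensor V) :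
    ∑ μ : Module.End.Eigenvalues ((B : Lin V) : V →ₗ[ℝ] V), (eigenProj B μ : Lin V) = 1 := by
  ext v
  have hB := isSymmetric_coe B
  have := hB.orthogonalFamily_eigenspaces'.sum_projection_of_mem_iSup v (by
    have h := Submodule.orthogonal_eq_bot_iff.1 hB.orthogonalComplement_iSup_eigenspaces_eq_bot'
    rw [h]; trivial)
  simpa [eigenProj] using this

theorem tensorFun_eval (p : ℝ[X]) (B : SymTensor V) :
    (tensorFun (fun x => p.eval x) B : Lin V) = aeval (B : Lin V) p := by
  have hstep : ∀ μ : ℝ, (eigenProj B μ : Lin V) * aeval (B : Lin V) p =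
      p.eval μ • (eigenProj B μ : Lin V) := fun μ => by
    have := proj_mul_aeval_add_eq (P := fun _ : Unit => (eigenProj B μ : Lin V))
      (ev := fun _ => μ) (i := ()) (eigenProj_mul B μ) 0 p
    simpa using this
  conv_rhs => rw [← one_mul (aeval (B : Lin V) p), ← sum_eigenProj B, Finset.sum_mul]
  simp [tensorFun, hstep]

omit [CompleteSpace V] in
theorem card_eigenvalues_le (T : V →ₗ[ℝ] V) :
    Fintype.card (Module.End.Eigenvalues T) ≤ Module.finrank ℝ V := by
  choose v hv using fun μ : Module.End.Eigenvalues T =>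
    Module.End.HasEigenvalue.exists_hasEigenvector μ.2
  exact (Module.End.eigenvectors_linearIndependent' T (fun μ : Module.End.Eigenvalues T => (μ : ℝ))
    Subtype.val_injective v hv).fintype_card_le_finrank

omit [FiniteDimensional ℝ V] in
theorem abs_eigenvalue_le (B : SymTensor V)
    (μ : Module.End.Eigenvalues ((B : Lin V) : V →ₗ[ℝ] V)) : |(μ : ℝ)| ≤ ‖B‖ := by
  obtain ⟨v, hv⟩ := Module.End.HasEigenvalue.exists_hasEigenvector μ.2
  have hv0 : 0 < ‖v‖ := norm_pos_iff.2 hv.2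
  have h1 : (B : Lin V) v = (μ : ℝ) • v := hv.apply_eq_smul
  have h2 := (B : Lin V).le_opNorm v
  rw [h1, norm_smul, Real.norm_eq_abs] at h2
  exact le_of_mul_le_mul_right h2 hv0

/-- The derivatives of `B ↦ p(B)` on a ball are controlled by the derivative of the same order of the
polynomial `p` on an interval, uniformly in `p`. -/
theorem norm_iteratedFDeriv_aeval_le {B : SymTensor V} {R : ℝ} (hB : ‖B‖ ≤ R) {p : ℝ[X]} {n : ℕ}
    {M : ℝ} (hM : 0 ≤ M) (hp : ∀ t ∈ Set.Icc (-R) R, |(derivative^[n] p).eval t| ≤ M)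
    (X : Fin n → SymTensor V) :
    ‖iteratedFDeriv ℝ n (fun B : SymTensor V => aeval (symInclusion B) p) B X‖ ≤
      n.factorial * ((Module.finrank ℝ V : ℝ) ^ (n + 1) * M) * ∏ k, ‖symInclusion (X k)‖ := by
  have hev : ∀ μ : Module.End.Eigenvalues ((B : Lin V) : V →ₗ[ℝ] V), (μ : ℝ) ∈ Set.Icc (-R) R :=
    fun μ => abs_le.1 ((abs_eigenvalue_le B μ).trans hB)
  have hPB : ∀ μ : Module.End.Eigenvalues ((B : Lin V) : V →ₗ[ℝ] V),
      (eigenProj B μ : Lin V) * symInclusion B = (μ : ℝ) • (eigenProj B μ : Lin V) :=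
    fun μ => eigenProj_mul B μ
  have hstar : ∀ μ : Module.End.Eigenvalues ((B : Lin V) : V →ₗ[ℝ] V),
      star (eigenProj B μ : Lin V) = (eigenProj B μ : Lin V) := fun μ => star_coe_symTensor _
  have hnorm : ∀ μ : Module.End.Eigenvalues ((B : Lin V) : V →ₗ[ℝ] V),
      ‖(eigenProj B μ : Lin V)‖ ≤ 1 := fun μ => norm_eigenProj_le B μ
  have h1 := sum_eigenProj B
  have hcard := card_eigenvalues_le ((B : Lin V) : V →ₗ[ℝ] V)
  have h := norm_iteratedFDeriv_aeval_apply_le (symInclusion (V := V))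
    (ev := fun μ : Module.End.Eigenvalues ((B : Lin V) : V →ₗ[ℝ] V) => (μ : ℝ))
    (P := fun μ : Module.End.Eigenvalues ((B : Lin V) : V →ₗ[ℝ] V) => (eigenProj B μ : Lin V))
    (p := p) (n := n) (N := Module.finrank ℝ V) (a := -R) (b := R) (M := M) (B := B)
  exact h hstar hnorm hPB h1 hcard hM hev hp X

end Spectral

/-! ### Approximation, limits and localization -/

section Approximation

theorem exists_derivative_eq (q : ℝ[X]) : ∃ p : ℝ[X], derivative p = q := by
  induction q using Polynomial.induction_on' with
  | add p q hp hq =>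
    obtain ⟨P, rfl⟩ := hp
    obtain ⟨Q, rfl⟩ := hq
    exact ⟨P + Q, derivative_add⟩
  | monomial n a =>
    refine ⟨monomial (n + 1) (a / (n + 1)), ?_⟩
    rw [derivative_monomial]
    simp only [Nat.cast_add, Nat.cast_one, Nat.add_sub_cancel]
    rw [div_mul_cancel₀ _ (by positivity)]

/-- Weierstrass approximation in `C^n` on an interval: approximate the `n`-th derivative and
integrate. -/
theorem exists_polynomial_iteratedDeriv_near {n : ℕ} {g : ℝ → ℝ} (hg : ContDiff ℝ n g) {R : ℝ}
    (hR : 0 ≤ R) {ε : ℝ} (hε : 0 < ε) :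
    ∃ p : ℝ[X], ∀ j ≤ n, ∀ x ∈ Set.Icc (-R) R,
      |iteratedDeriv j g x - (derivative^[j] p).eval x| ≤ ε := by
  induction n generalizing g ε with
  | zero =>
    obtain ⟨p, hp⟩ := exists_polynomial_near_of_continuousOn (-R) R g hg.continuous.continuousOn ε hε
    refine ⟨p, fun j hj x hx => ?_⟩
    obtain rfl : j = 0 := by omega
    rw [abs_sub_comm]
    simpa using (hp x hx).le
  | succ n ih =>
    have hg' := contDiff_succ_iff_deriv.1 (by exact_mod_cast hg : ContDiff ℝ ((n : WithTop ℕ∞) + 1) g)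
    have hδ : 0 < ε / (R + 1) := by positivity
    have hδε : ε / (R + 1) ≤ ε := div_le_self hε.le (by linarith)
    obtain ⟨q, hq⟩ := ih hg'.2.2 hδ
    obtain ⟨P, rfl⟩ := exists_derivative_eq q
    refine ⟨P + C (g 0 - P.eval 0), fun j hj x hx => ?_⟩
    rcases j with _ | j
    · have hd : ∀ t ∈ Set.Icc (-R) R, HasDerivWithinAt
          (fun t => g t - (P + C (g 0 - P.eval 0)).eval t)
          (deriv g t - (derivative P).eval t) (Set.Icc (-R) R) t := fun t _ => by
        have h := ((hg'.1 t).hasDerivAt.sub ((P + C (g 0 - P.eval 0)).hasDerivAt t))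
        rw [derivative_add, derivative_C, add_zero] at h
        exact h.hasDerivWithinAt
      have hb : ∀ t ∈ Set.Icc (-R) R, ‖deriv g t - (derivative P).eval t‖ ≤ ε / (R + 1) :=
        fun t ht => by simpa using hq 0 (Nat.zero_le _) t ht
      have h0 : (0 : ℝ) ∈ Set.Icc (-R) R := ⟨by linarith, hR⟩
      have h := (convex_Icc (-R) R).norm_image_sub_le_of_norm_hasDerivWithin_le hd hb h0 hx
      simp only [eval_add, eval_C, add_sub_cancel, sub_self, sub_zero, Real.norm_eq_abs] at h
      simp only [iteratedDeriv_zero, Function.iterate_zero, id, eval_add, eval_C]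
      refine h.trans ?_
      have hxR : |x| ≤ R + 1 := (abs_le.2 hx).trans (by linarith)
      calc ε / (R + 1) * |x| ≤ ε / (R + 1) * (R + 1) := by gcongr
        _ = ε := div_mul_cancel₀ _ (by positivity)
    · rw [iteratedDeriv_succ', Function.iterate_succ_apply, derivative_add, derivative_C, add_zero]
      exact (hq j (by omega) x hx).trans hδε

theorem exists_polynomial_seq_near {n : ℕ} {g : ℝ → ℝ} (hg : ContDiff ℝ n g) {R : ℝ}
    (hR : 0 ≤ R) : ∃ p : ℕ → ℝ[X], ∀ k, ∀ j ≤ n, ∀ x ∈ Set.Icc (-R) R,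
      |iteratedDeriv j g x - (derivative^[j] (p k)).eval x| ≤ 1 / ((k : ℝ) + 1) := by
  choose p hp using fun k : ℕ =>
    exists_polynomial_iteratedDeriv_near hg hR (Nat.one_div_pos_of_nat (α := ℝ) (n := k))
  exact ⟨p, hp⟩

end Approximation

section Limits

open Filter Topology

variable {E G : Type*} [NormedAddCommGroup E] [NormedSpace ℝ E] [NormedAddCommGroup G]
  [NormedSpace ℝ G]

/-- If the derivatives up to order `n` of `C^n` maps are uniformly Cauchy on an open set, then the
pointwise limit is `C^n` and its `n`-th derivative is the limit of the `n`-th derivatives. -/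
theorem contDiffOn_of_uniformCauchySeqOn [CompleteSpace G] {F : ℕ → E → G} {f : E → G} {U : Set E}
    (hU : IsOpen U) {n : ℕ} (hF : ∀ k, ContDiff ℝ n (F k))
    (hC : ∀ m ≤ n, UniformCauchySeqOn (fun k => iteratedFDeriv ℝ m (F k)) atTop U)
    (hf : ∀ x ∈ U, Tendsto (fun k => F k x) atTop (𝓝 (f x))) :
    ContDiffOn ℝ n f U ∧ ∀ x ∈ U,
      Tendsto (fun k => iteratedFDeriv ℝ n (F k) x) atTop (𝓝 (iteratedFDeriv ℝ n f x)) := by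
  let p : E → FormalMultilinearSeries ℝ E G := fun x m =>
    limUnder atTop fun k => iteratedFDeriv ℝ m (F k) x
  have hp : ∀ m ≤ n, ∀ x ∈ U,
      Tendsto (fun k => iteratedFDeriv ℝ m (F k) x) atTop (𝓝 (p x m)) := fun m hm x hx =>
    ((hC m hm).cauchySeq hx).tendsto_limUnder
  have hpu : ∀ m ≤ n, TendstoUniformlyOn (fun k => iteratedFDeriv ℝ m (F k)) (fun x => p x m)
      atTop U := fun m hm => (hC m hm).tendstoUniformlyOn_of_tendsto (hp m hm)
  have hT : HasFTaylorSeriesUpToOn n f p U := by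
    refine ⟨fun x hx => ?_, fun m hm x hx => ?_, fun m hm => ?_⟩
    · have h1 := ((ContinuousMultilinearMap.apply ℝ (fun _ : Fin 0 => E) G
        (0 : Fin 0 → E)).continuous.tendsto _).comp (hp 0 (Nat.zero_le _) x hx)
      refine tendsto_nhds_unique h1 ?_
      simpa [Function.comp_def] using hf x hx
    · have hm' : m + 1 ≤ n := by exact_mod_cast hm
      have hcurry := (continuousMultilinearCurryLeftEquiv ℝ (fun _ : Fin (m + 1) => E)
        G).isometry.uniformContinuous.comp_tendstoUniformlyOn (hpu (m + 1) hm')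
      refine (hasFDerivAt_of_tendstoUniformlyOn hU hcurry (fun k y _ => ?_)
        (hp m (by omega)) hx).hasFDerivWithinAt
      exact (hF k).ftaylorSeries.fderiv m (by exact_mod_cast hm') y
    · have hm' : m ≤ n := by exact_mod_cast hm
      refine (hpu m hm').continuousOn (Frequently.of_forall fun k => ?_)
      exact ((hF k).continuous_iteratedFDeriv (by exact_mod_cast hm')).continuousOn
  refine ⟨hT.contDiffOn, fun x hx => ?_⟩
  have h := hT.eq_iteratedFDerivWithin_of_uniqueDiffOn le_rfl hU.uniqueDiffOn hx
  rw [iteratedFDerivWithin_of_isOpen n hU hx] at h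
  rw [← h]
  exact hp n le_rfl x hx

theorem contDiffAt_of_comp_leftInverse {H : Type*} [NormedAddCommGroup H] [NormedSpace ℝ H]
    {L : G →L[ℝ] H} {S : H →L[ℝ] G} (hS : ∀ x, S (L x) = x) {n : ℕ} {f : E → G} {x : E}
    (hf : ContDiffAt ℝ n (fun x => L (f x)) x) :
    ContDiffAt ℝ n f x ∧ ∀ X : Fin n → E,
      L (iteratedFDeriv ℝ n f x X) = iteratedFDeriv ℝ n (fun x => L (f x)) x X := by
  have h : ContDiffAt ℝ n f x := by
    have := S.contDiff.contDiffAt.comp x hf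
    simpa [Function.comp_def, hS] using this
  refine ⟨h, fun X => ?_⟩
  have := L.iteratedFDeriv_comp_left h (i := n) le_rfl
  simp only [Function.comp_def] at this
  rw [this]
  rfl

end Limits

section Localization

open Filter Topology

/-- Multiply `f` by a bump function that is one near the `α_l` and vanishes where `f` is not known to
be `C^n`. -/
theorem exists_contDiff_eventuallyEq {n d : ℕ} {f : ℝ → ℝ} {α : Fin d → ℝ}
    (hf : ∀ l, ContDiffAt ℝ n f (α l)) :
    ∃ g : ℝ → ℝ, ContDiff ℝ n g ∧ ∀ l, f =ᶠ[𝓝 (α l)] g := by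
  have hUo : IsOpen {x | ContDiffAt ℝ n f x} :=
    isOpen_iff_mem_nhds.2 fun x hx => (show ContDiffAt ℝ n f x from hx).eventually (by simp)
  have hK : IsClosed (Set.range α) := (Set.finite_range α).isClosed
  obtain ⟨W, hWo, hKW, hWU⟩ := normal_exists_closure_subset hK hUo
    (by rintro _ ⟨l, rfl⟩; exact hf l)
  obtain ⟨χ, h1, h0, -⟩ := exists_contMDiffMap_one_nhds_of_subset_interior
    (n := n) (modelWithCornersSelf ℝ ℝ) hK (t := W) (by rwa [hWo.interior_eq])
  refine ⟨fun x => χ x * f x, contDiff_iff_contDiffAt.2 fun x => ?_, fun l => ?_⟩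
  · by_cases hx : x ∈ closure W
    · exact χ.contMDiff.contDiff.contDiffAt.mul (hWU hx)
    · refine (contDiffAt_const (c := (0 : ℝ))).congr_of_eventuallyEq ?_
      filter_upwards [isClosed_closure.isOpen_compl.mem_nhds hx] with y hy
      rw [h0 y fun h => hy (subset_closure h), zero_mul]
  · filter_upwards [h1.filter_mono (nhds_le_nhdsSet (Set.mem_range_self l))] with y hy
    rw [hy, one_mul]

variable {V : Type*} [NormedAddCommGroup V] [InnerProductSpace ℝ V] [CompleteSpace V]

/-- Eigenvalues of symmetric tensors near `A` are near eigenvalues of `A`: if `B v = μ v`, then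
`(α_i - μ) P_i v = P_i (A - B) v`. -/
theorem exists_abs_eigenvalue_sub_lt {d : ℕ} {A : SymTensor V} {α : Fin d → ℝ}
    {P : Fin d → SymTensor V} (h : IsSpectralDecomposition A α P) {δ : ℝ} (hδ : 0 < δ) :
    ∃ r > 0, ∀ B : SymTensor V, ‖(A : Lin V) - (B : Lin V)‖ < r →
      ∀ (μ : ℝ) (v : V), v ≠ 0 → (B : Lin V) v = μ • v → ∃ l, |μ - α l| < δ := by
  set K := ∑ i, ‖(P i : Lin V)‖ with hK
  have hK0 : 0 ≤ K := Finset.sum_nonneg fun _ _ => norm_nonneg _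
  refine ⟨δ / (K + 1), by positivity, fun B hB μ v hv hBv => ?_⟩
  by_contra! hfar
  have hv0 : 0 < ‖v‖ := norm_pos_iff.2 hv
  have hi : ∀ i, δ * ‖(P i : Lin V) v‖ ≤ ‖(P i : Lin V)‖ * (δ / (K + 1) * ‖v‖) := fun i => by
    have h1 : (P i : Lin V) (((A : Lin V) - (B : Lin V)) v) = (α i - μ) • (P i : Lin V) v := by
      have h2 : (P i : Lin V) ((A : Lin V) v) = α i • (P i : Lin V) v :=
        congrArg (fun T : Lin V => T v) (h.proj_mul i)
      rw [sub_apply, map_sub, h2, hBv, map_smul, sub_smul]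
    calc δ * ‖(P i : Lin V) v‖ ≤ |α i - μ| * ‖(P i : Lin V) v‖ := by
          gcongr
          rw [abs_sub_comm]
          exact hfar i
      _ = ‖(P i : Lin V) (((A : Lin V) - (B : Lin V)) v)‖ := by
          rw [h1, norm_smul, Real.norm_eq_abs]
      _ ≤ ‖(P i : Lin V)‖ * ‖((A : Lin V) - (B : Lin V)) v‖ := (P i : Lin V).le_opNorm _
      _ ≤ ‖(P i : Lin V)‖ * (δ / (K + 1) * ‖v‖) := by
          gcongr
          exact (((A : Lin V) - (B : Lin V)).le_opNorm v).trans (by gcongr)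
  have hsum : v = ∑ i, (P i : Lin V) v := by
    have := congrArg (fun T : Lin V => T v) h.sum_eq_one
    simpa [sum_apply] using this.symm
  have hle : δ * ‖v‖ ≤ K * (δ / (K + 1) * ‖v‖) := by
    calc δ * ‖v‖ ≤ δ * ∑ i, ‖(P i : Lin V) v‖ := by
          gcongr
          conv_lhs => rw [hsum]
          exact norm_sum_le _ _
      _ ≤ _ := by
          rw [Finset.mul_sum, hK, Finset.sum_mul]
          exact Finset.sum_le_sum fun i _ => hi i
  have hlt : K * (δ / (K + 1) * ‖v‖) < δ * ‖v‖ := by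
    have h1 : K * (δ / (K + 1) * ‖v‖) = K / (K + 1) * (δ * ‖v‖) := by ring
    have h2 : K / (K + 1) < 1 := (div_lt_one (by positivity)).2 (by linarith)
    rw [h1]
    nlinarith [mul_pos hδ hv0]
  exact absurd hle (not_le.2 hlt)

variable [FiniteDimensional ℝ V]

/-- Near `A`, a tensor function depends only on the values of the function near the eigenvalues of
`A`. -/
theorem tensorFun_eventuallyEq {d : ℕ} {A : SymTensor V} {α : Fin d → ℝ}
    {P : Fin d → SymTensor V} (h : IsSpectralDecomposition A α P) {f g : ℝ → ℝ}
    (hfg : ∀ l, f =ᶠ[𝓝 (α l)] g) :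
    tensorFun (V := V) f =ᶠ[𝓝 A] tensorFun g := by
  choose δ hδ hball using fun l => Metric.eventually_nhds_iff.1 (hfg l)
  obtain ⟨ε, hε, hεδ⟩ : ∃ ε > 0, ∀ l, ε ≤ δ l := by
    have h : ∀ᶠ ε : ℝ in 𝓝[>] 0, ∀ l, ε ≤ δ l :=
      eventually_all.2 fun l => (eventually_le_nhds (hδ l)).filter_mono nhdsWithin_le_nhds
    obtain ⟨ε, hε, hε0⟩ := (h.and self_mem_nhdsWithin).exists
    exact ⟨ε, hε0, hε⟩
  obtain ⟨r, hr, hB⟩ := exists_abs_eigenvalue_sub_lt h hε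
  filter_upwards [Metric.ball_mem_nhds A hr] with B hBr
  rw [Metric.mem_ball, dist_comm, dist_eq_norm] at hBr
  refine Finset.sum_congr rfl fun μ _ => ?_
  obtain ⟨v, hv⟩ := Module.End.HasEigenvalue.exists_hasEigenvector μ.2
  obtain ⟨l, hl⟩ := hB B hBr μ v hv.2 hv.apply_eq_smul
  rw [hball l (by rw [Real.dist_eq]; exact hl.trans_le (hεδ l))]

end Localization

/-! ### The derivatives of a tensor function -/

section Derivatives

open Filter Topology

variable {V : Type*} [NormedAddCommGroup V] [InnerProductSpace ℝ V] [CompleteSpace V]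

theorem contDiffAt_of_uniformCauchySeqOn {E G : Type*} [NormedAddCommGroup E] [NormedSpace ℝ E]
    [NormedAddCommGroup G] [NormedSpace ℝ G] [CompleteSpace G] {F : ℕ → E → G} {f : E → G} {a : E}
    {r : ℝ} (hr : 0 < r) {n : ℕ} (hF : ∀ k, ContDiff ℝ n (F k))
    (hC : ∀ m ≤ n,
      UniformCauchySeqOn (fun k => iteratedFDeriv ℝ m (F k)) atTop (Metric.ball a r))
    (hf : ∀ x ∈ Metric.ball a r, Tendsto (fun k => F k x) atTop (𝓝 (f x))) :
    ContDiffAt ℝ n f a ∧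
      Tendsto (fun k => iteratedFDeriv ℝ n (F k) a) atTop (𝓝 (iteratedFDeriv ℝ n f a)) := by
  have h := contDiffOn_of_uniformCauchySeqOn Metric.isOpen_ball hF hC hf
  exact ⟨h.1.contDiffAt (Metric.ball_mem_nhds a hr), h.2 a (Metric.mem_ball_self hr)⟩

theorem norm_le_of_mem_ball_one {E : Type*} [SeminormedAddCommGroup E] {a b : E}
    (hb : b ∈ Metric.ball a 1) : ‖b‖ ≤ ‖a‖ + 1 := by
  have := norm_le_norm_add_norm_sub' b a
  rw [Metric.mem_ball, dist_eq_norm] at hb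
  linarith

omit [CompleteSpace V] in
/-- If the `m`-th derivatives of the tensor functions of polynomials are bounded linearly by those of
the polynomials, then uniform convergence passes from the polynomials to the tensor functions. -/
theorem uniformCauchySeqOn_iteratedFDeriv_aeval {E : Type*} [NormedAddCommGroup E]
    [NormedSpace ℝ E] (L : E →L[ℝ] Lin V) {U : Set E} {m : ℕ} {I : Set ℝ}
    {C : ℝ} (hC : 0 ≤ C)
    (hbound : ∀ B ∈ U, ∀ (q : ℝ[X]) (M : ℝ), 0 ≤ M →
      (∀ t ∈ I, |(derivative^[m] q).eval t| ≤ M) → ∀ X : Fin m → E,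
        ‖iteratedFDeriv ℝ m (fun B => aeval (L B) q) B X‖ ≤ C * M * ∏ k, ‖X k‖)
    {p : ℕ → ℝ[X]} {g : ℝ → ℝ}
    (hp : ∀ k, ∀ t ∈ I, |g t - (derivative^[m] (p k)).eval t| ≤ 1 / ((k : ℝ) + 1)) :
    UniformCauchySeqOn (fun k => iteratedFDeriv ℝ m fun B => aeval (L B) (p k)) atTop U := by
  rw [Metric.uniformCauchySeqOn_iff]
  intro ε hε
  obtain ⟨N, hN⟩ := exists_nat_one_div_lt (show 0 < ε / (2 * (C + 1)) by positivity)
  refine ⟨N, fun k hk l hl B hB => ?_⟩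
  have hpN : ∀ k ≥ N, ∀ t ∈ I, |g t - (derivative^[m] (p k)).eval t| ≤ 1 / ((N : ℝ) + 1) :=
    fun k hk t ht => (hp k t ht).trans (Nat.one_div_le_one_div hk)
  have hq : ∀ t ∈ I, |(derivative^[m] (p k - p l)).eval t| ≤ 2 * (1 / ((N : ℝ) + 1)) := by
    intro t ht
    rw [iterate_map_sub, eval_sub]
    have h1 := abs_le.1 (hpN k hk t ht)
    have h2 := abs_le.1 (hpN l hl t ht)
    exact abs_le.2 ⟨by linarith [h1.1, h1.2, h2.1, h2.2], by linarith [h1.1, h1.2, h2.1, h2.2]⟩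
  have hsub : iteratedFDeriv ℝ m (fun B => aeval (L B) (p k)) B -
      iteratedFDeriv ℝ m (fun B => aeval (L B) (p l)) B =
        iteratedFDeriv ℝ m (fun B => aeval (L B) (p k - p l)) B := by
    simp only [map_sub]
    exact (fun_iteratedFDeriv_sub_apply (contDiff_aeval_comp L (p k)).contDiffAt
      (contDiff_aeval_comp L (p l)).contDiffAt).symm
  have hnorm : ‖iteratedFDeriv ℝ m (fun B => aeval (L B) (p k - p l)) B‖ ≤
      C * (2 * (1 / ((N : ℝ) + 1))) := by
    exact ContinuousMultilinearMap.opNorm_le_bound (by positivity) fun X =>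
      hbound B hB _ _ (by positivity) hq X
  rw [dist_eq_norm, hsub]
  calc _ ≤ C * (2 * (1 / ((N : ℝ) + 1))) := hnorm
    _ ≤ (C + 1) * (2 * (1 / ((N : ℝ) + 1))) := by gcongr; linarith
    _ < (C + 1) * (2 * (ε / (2 * (C + 1)))) := by gcongr
    _ = ε := by field_simp

variable [FiniteDimensional ℝ V]

theorem coe_tensorFun (f : ℝ → ℝ) (B : SymTensor V) :
    (tensorFun f B : Lin V) = ∑ μ : Module.End.Eigenvalues ((B : Lin V) : V →ₗ[ℝ] V),
      f μ • (eigenProj B μ : Lin V) := by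
  simp [tensorFun]

theorem uniformCauchySeqOn_iteratedFDeriv_aeval_symInclusion (A : SymTensor V) {m : ℕ}
    {p : ℕ → ℝ[X]} {g : ℝ → ℝ} (hp : ∀ k, ∀ t ∈ Set.Icc (-(‖A‖ + 1)) (‖A‖ + 1),
      |g t - (derivative^[m] (p k)).eval t| ≤ 1 / ((k : ℝ) + 1)) :
    UniformCauchySeqOn
      (fun k => iteratedFDeriv ℝ m fun B : SymTensor V => aeval (symInclusion B) (p k)) atTop
      (Metric.ball A 1) := by
  apply uniformCauchySeqOn_iteratedFDeriv_aeval (E := SymTensor V) symInclusion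
    (C := m.factorial * (Module.finrank ℝ V : ℝ) ^ (m + 1)) ?_ ?_ hp
  · positivity
  · intro B hB q M hM hq X
    have h := norm_iteratedFDeriv_aeval_le (norm_le_of_mem_ball_one hB) hM hq X
    rw [← mul_assoc (m.factorial : ℝ)] at h
    exact h

theorem tendsto_aeval_symInclusion {B : SymTensor V} {R : ℝ} (hB : ‖B‖ ≤ R) {p : ℕ → ℝ[X]}
    {g : ℝ → ℝ}
    (hp : ∀ x ∈ Set.Icc (-R) R, Tendsto (fun k => (p k).eval x) atTop (𝓝 (g x))) :
    Tendsto (fun k => aeval (symInclusion B) (p k)) atTop (𝓝 (symInclusion (tensorFun g B))) := by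
  simp only [symInclusion_apply, ← tensorFun_eval, coe_tensorFun]
  refine tendsto_finsetSum _ fun μ _ => ?_
  exact (hp μ (abs_le.1 ((abs_eigenvalue_le B μ).trans hB))).smul_const _

/-- On a ball, a tensor function of class `C^n` is the limit in `C^n` of polynomials. -/
theorem contDiffAt_symInclusion_tensorFun {n : ℕ} {g : ℝ → ℝ} {A : SymTensor V} {p : ℕ → ℝ[X]}
    (hp : ∀ k, ∀ j ≤ n, ∀ x ∈ Set.Icc (-(‖A‖ + 1)) (‖A‖ + 1),
      |iteratedDeriv j g x - (derivative^[j] (p k)).eval x| ≤ 1 / ((k : ℝ) + 1))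
    (hlim : ∀ x ∈ Set.Icc (-(‖A‖ + 1)) (‖A‖ + 1),
      Tendsto (fun k => (p k).eval x) atTop (𝓝 (g x))) :
    ContDiffAt ℝ n (fun B => symInclusion (tensorFun (V := V) g B)) A ∧
      Tendsto (fun k => iteratedFDeriv ℝ n (fun B : SymTensor V => aeval (symInclusion B) (p k)) A)
        atTop (𝓝 (iteratedFDeriv ℝ n (fun B => symInclusion (tensorFun (V := V) g B)) A)) := by
  apply contDiffAt_of_uniformCauchySeqOn (E := SymTensor V) one_pos
  · intro k
    exact contDiff_aeval_comp (E := SymTensor V) symInclusion (p k)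
  · intro m hm
    exact uniformCauchySeqOn_iteratedFDeriv_aeval_symInclusion A fun k => hp k m hm
  · intro B hB
    exact tendsto_aeval_symInclusion (norm_le_of_mem_ball_one hB) hlim

theorem exists_polynomial_tendsto_iteratedFDeriv_tensorFun {n : ℕ} {g : ℝ → ℝ}
    (hg : ContDiff ℝ n g) (A : SymTensor V) :
    ∃ p : ℕ → ℝ[X],
      (∀ j ≤ n, ∀ x ∈ Set.Icc (-(‖A‖ + 1)) (‖A‖ + 1),
        Tendsto (fun k => (derivative^[j] (p k)).eval x) atTop (𝓝 (iteratedDeriv j g x))) ∧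
      ContDiffAt ℝ n (fun B => symInclusion (tensorFun (V := V) g B)) A ∧
      Tendsto (fun k => iteratedFDeriv ℝ n (fun B : SymTensor V => aeval (symInclusion B) (p k)) A)
        atTop (𝓝 (iteratedFDeriv ℝ n (fun B => symInclusion (tensorFun (V := V) g B)) A)) := by
  obtain ⟨p, hp⟩ := exists_polynomial_seq_near hg (show 0 ≤ ‖A‖ + 1 by positivity)
  have hlim : ∀ j ≤ n, ∀ x ∈ Set.Icc (-(‖A‖ + 1)) (‖A‖ + 1),
      Tendsto (fun k => (derivative^[j] (p k)).eval x) atTop (𝓝 (iteratedDeriv j g x)) := by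
    intro j hj x hx
    rw [tendsto_iff_dist_tendsto_zero]
    refine squeeze_zero (fun _ => dist_nonneg) (fun k => ?_) tendsto_one_div_add_atTop_nhds_zero_nat
    rw [dist_comm, Real.dist_eq]
    exact hp k j hj x hx
  have hlim0 := hlim 0 (Nat.zero_le n)
  simp only [Function.iterate_zero, id, iteratedDeriv_zero] at hlim0
  exact ⟨p, hlim, contDiffAt_symInclusion_tensorFun hp hlim0⟩

omit [FiniteDimensional ℝ V] in
theorem IsSpectralDecomposition.abs_le_norm {d : ℕ} {A : SymTensor V} {α : Fin d → ℝ}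
    {P : Fin d → SymTensor V} (h : IsSpectralDecomposition A α P) (l : Fin d) : |α l| ≤ ‖A‖ := by
  have h1 := congrArg norm (h.proj_mul l)
  rw [norm_smul, Real.norm_eq_abs] at h1
  have h0 : 0 < ‖(P l : Lin V)‖ := norm_pos_iff.2 fun h' => h.ne_zero l (Subtype.ext h')
  refine le_of_mul_le_mul_right ?_ h0
  rw [← h1, mul_comm]
  exact norm_mul_le _ _

theorem exists_leftInverse_symInclusion :
    ∃ S : Lin V →L[ℝ] SymTensor V, ∀ B, S (symInclusion B) = B := by
  obtain ⟨S, hS⟩ := (symInclusion (V := V)).toLinearMap.exists_leftInverse_of_injective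
    (LinearMap.ker_eq_bot.2 Subtype.val_injective)
  exact ⟨S.toContinuousLinearMap, fun B => congrArg (fun T => T B) hS⟩

/-- Replace `f` by a globally `C^n` function, approximate that one by polynomials, and pass to the
limit in the formula for polynomials. The derivatives are computed for maps into all of `Lin V` and
brought back to the symmetric tensors by a linear left inverse of the inclusion. -/
theorem iteratedFDeriv_tensorFun {n d : ℕ} {f : ℝ → ℝ} {A : SymTensor V} {α : Fin d → ℝ}
    {P : Fin d → SymTensor V} (h : IsSpectralDecomposition A α P)
    (hf : ∀ l, ContDiffAt ℝ n f (α l)) :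
    ContDiffAt ℝ n (tensorFun (V := V) f) A ∧ ∀ X : Fin n → SymTensor V,
      (iteratedFDeriv ℝ n (tensorFun (V := V) f) A X : Lin V) =
        ∑ σ : Equiv.Perm (Fin n), ∑ i : Fin (n + 1) → Fin d,
          residueCoeff f α (occurrences i) •
            boxContract (fun s => (P (i s) : Lin V)) (fun k => (X (σ k) : Lin V)) := by
  obtain ⟨g, hg, hfg⟩ := exists_contDiff_eventuallyEq hf
  have hle : ∀ (i : Fin (n + 1) → Fin d) l, occurrences i l ≤ n + 1 := fun i l =>
    (Finset.single_le_sum (fun _ _ => Nat.zero_le _) (Finset.mem_univ l)).trans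
      (sum_occurrences i).le
  have hcoeff : ∀ i : Fin (n + 1) → Fin d, residueCoeff f α (occurrences i) =
      residueCoeff g α (occurrences i) := fun i =>
    residueCoeff_congr h.injective (hle i) hf (fun l => hg.contDiffAt) fun l j _ =>
      (hfg l).iteratedDeriv_eq j
  have hloc := tensorFun_eventuallyEq h hfg
  obtain ⟨p, hlim, hdiff, htend⟩ := exists_polynomial_tendsto_iteratedFDeriv_tensorFun hg A
  obtain ⟨S, hS⟩ := exists_leftInverse_symInclusion (V := V)
  obtain ⟨hg1, hg2⟩ := contDiffAt_of_comp_leftInverse (L := symInclusion (V := V)) (S := S) hS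
    (f := tensorFun (V := V) g) hdiff
  refine ⟨hg1.congr_of_eventuallyEq hloc, fun X => ?_⟩
  have heq : iteratedFDeriv ℝ n (tensorFun (V := V) f) A =
      iteratedFDeriv ℝ n (tensorFun (V := V) g) A := by
    apply Filter.EventuallyEq.eq_of_nhds
    apply Filter.EventuallyEq.iteratedFDeriv
    exact hloc
  rw [heq, ← symInclusion_apply, hg2 X]
  have h1 : Tendsto
      (fun k => iteratedFDeriv ℝ n (fun B : SymTensor V => aeval (symInclusion B) (p k)) A X) atTop
      (𝓝 (iteratedFDeriv ℝ n (fun B => symInclusion (tensorFun (V := V) g B)) A X)) :=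
    ((ContinuousMultilinearMap.apply ℝ (fun _ : Fin n => SymTensor V) (Lin V)
      X).continuous.tendsto _).comp htend
  refine tendsto_nhds_unique h1 ?_
  have hpoly : ∀ k, iteratedFDeriv ℝ n (fun B : SymTensor V => aeval (symInclusion B) (p k)) A X =
      ∑ σ : Equiv.Perm (Fin n), ∑ i : Fin (n + 1) → Fin d,
        residueCoeff (fun x => (p k).eval x) α (occurrences i) •
          boxContract (fun s => (P (i s) : Lin V)) (fun k => (X (σ k) : Lin V)) := fun k => by
    have hPB : ∀ i, (P i : Lin V) * symInclusion A = α i • (P i : Lin V) := h.proj_mul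
    have := iteratedFDeriv_aeval (symInclusion (V := V)) (B := A) (ev := α)
      (P := fun i => (P i : Lin V)) (fun i => star_coe_symTensor _) hPB h.sum_eq_one (p k) X
    rw [this]
    simp only [residueCoeff_eval_eq_dividedDiff h.injective]
    rfl
  simp only [hpoly, hcoeff]
  refine tendsto_finsetSum _ fun σ _ => tendsto_finsetSum _ fun i _ => Tendsto.smul_const ?_ _
  obtain ⟨w, hw⟩ := exists_residueCoeff_eq_sum (n := n) h.injective (hle i)
  rw [hw g fun l => hg.contDiffAt]
  simp only [fun k => hw (fun x => (p k).eval x) fun l => (contDiff_eval (p k)).contDiffAt]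
  refine tendsto_finsetSum _ fun l _ => tendsto_finsetSum _ fun j hj => Tendsto.const_mul _ ?_
  simp only [iteratedDeriv_eval]
  have hjn : j ≤ n := by
    have := Finset.mem_range.1 hj
    have := hle i l
    omega
  exact hlim j hjn (α l) (abs_le.1 ((h.abs_le_norm l).trans (by linarith)))

end Derivatives

/-! ### Counting the coefficients -/

section Counting

theorem exists_occurrences_eq {n d : ℕ} {ν : Fin d → ℕ} (hν : ∑ l, ν l = n + 1) :
    ∃ i : Fin (n + 1) → Fin d, occurrences i = ν := by
  let e : (Σ l, Fin (ν l)) ≃ Fin (n + 1) := finSigmaFinEquiv.trans (finCongr hν)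
  refine ⟨fun s => (e.symm s).1, funext fun l => ?_⟩
  have h : (Finset.univ.filter fun s => (e.symm s).1 = l) =
      Finset.univ.map ((Function.Embedding.sigmaMk l).trans e.toEmbedding) := by
    ext s
    simp only [Finset.mem_filter, Finset.mem_univ, true_and, Finset.mem_map]
    constructor
    · rintro rfl
      exact ⟨(e.symm s).2, by simp⟩
    · rintro ⟨j, rfl⟩
      simp
  rw [occurrences, h, Finset.card_map, Finset.card_univ, Fintype.card_fin]

/-- For `f(x) = x^(n+1)` the leading coefficient of the interpolating polynomial is the sum of the
nodes, because `x^(n+1) - ∏ (x - x_s)` has degree at most `n`. -/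
theorem residueCoeff_pow {n d : ℕ} {α : Fin d → ℝ} (hα : Function.Injective α) {ν : Fin d → ℕ}
    (hν : ∑ l, ν l = n + 1) :
    residueCoeff (fun x => x ^ (n + 1)) α ν = ∑ l, ν l * α l := by
  obtain ⟨i, rfl⟩ := exists_occurrences_eq hν
  have hM : (∏ s, (X - C (α (i s)))).Monic := monic_prod_of_monic _ _ fun _ _ => monic_X_sub_C _
  have hdeg := degree_prod_X_sub_C fun s => α (i s)
  have hmod : (X ^ (n + 1) : ℝ[X]) %ₘ (∏ s, (X - C (α (i s)))) =
      X ^ (n + 1) - ∏ s, (X - C (α (i s))) := by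
    refine ((div_modByMonic_unique 1 _ hM ⟨by ring, ?_⟩).2)
    rw [hdeg]
    have h := degree_sub_lt_left (p := (X ^ (n + 1) : ℝ[X])) (q := ∏ s, (X - C (α (i s))))
      (by rw [hdeg, degree_X_pow]) (pow_ne_zero _ X_ne_zero)
      (by rw [hM.leadingCoeff, leadingCoeff_X_pow])
    rwa [degree_X_pow] at h
  have h := residueCoeff_eval_eq_dividedDiff hα (X ^ (n + 1)) i
  simp only [eval_pow, eval_X] at h
  rw [h, dividedDiff_eq_coeff_modByMonic]
  simp only [Function.comp_apply]
  rw [hmod, coeff_sub, coeff_X_pow, if_neg (Nat.lt_succ_self n).ne]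
  have hc := prod_X_sub_C_coeff_card_pred Finset.univ (fun s => α (i s)) (by simp)
  rw [Finset.card_univ, Fintype.card_fin, Nat.add_sub_cancel] at hc
  rw [hc, zero_sub, neg_neg, ← Finset.sum_fiberwise _ i]
  refine Finset.sum_congr rfl fun l _ => ?_
  rw [Finset.sum_congr rfl fun s hs => by rw [(Finset.mem_filter.1 hs).2], Finset.sum_const,
    nsmul_eq_mul]
  rfl

theorem residueCoeff_comp_perm {d : ℕ} (f : ℝ → ℝ) (α : Fin d → ℝ) (ν : Fin d → ℕ)
    (σ : Equiv.Perm (Fin d)) : residueCoeff f (α ∘ σ) (ν ∘ σ) = residueCoeff f α ν := by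
  unfold residueCoeff
  refine Finset.sum_equiv σ (by simp) fun l _ => ?_
  have h : ∀ x, ∏ m ∈ Finset.univ.erase l, (x - (α ∘ σ) m) ^ (ν ∘ σ) m =
      ∏ m ∈ Finset.univ.erase (σ l), (x - α m) ^ ν m := fun x =>
    Finset.prod_equiv σ (by simp) fun m _ => rfl
  simp only [h]
  rfl

theorem eq_of_coeffExpression_eq {n : ℕ} {ν ν' : Fin 3 → ℕ} (hν : ∑ l, ν l = n + 1)
    (hν' : ∑ l, ν' l = n + 1) (h : coeffExpression n ν = coeffExpression n ν') : ν = ν' := by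
  have key : ∀ α : Fin 3 → ℝ, Function.Injective α → ∑ l, (ν l : ℝ) * α l = ∑ l, ν' l * α l := by
    intro α hα
    have := congrFun (congrFun h ⟨fun x => x ^ (n + 1), contDiff_id.pow _⟩) ⟨α, hα⟩
    rwa [coeffExpression, coeffExpression, residueCoeff_pow hα hν, residueCoeff_pow hα hν'] at this
  have inj : ∀ c : ℝ, 1 < c → Function.Injective ![0, 1, c] := by
    intro c hc i j hij
    fin_cases i <;> fin_cases j <;> simp at hij ⊢ <;> linarith
  have h1 := key _ (inj 2 (by norm_num))
  have h2 := key _ (inj 3 (by norm_num))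
  simp only [Fin.sum_univ_three, Matrix.cons_val] at h1 h2
  rw [Fin.sum_univ_three] at hν hν'
  have h3 : (ν 2 : ℝ) = ν' 2 := by linarith
  have h4 : (ν 1 : ℝ) = ν' 1 := by linarith
  have h5 : ν 2 = ν' 2 := by exact_mod_cast h3
  have h6 : ν 1 = ν' 1 := by exact_mod_cast h4
  funext l
  fin_cases l
  · show ν 0 = ν' 0
    omega
  · exact h6
  · exact h5

theorem sum_comp_perm_eq {d N : ℕ} {ν : Fin d → ℕ} (hν : ∑ l, ν l = N) (σ : Equiv.Perm (Fin d)) :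
    ∑ l, (ν ∘ σ) l = N :=
  (Equiv.sum_comp σ ν).trans hν

theorem sameExpression_iff {n : ℕ} {ν ν' : Fin 3 → ℕ} (hν : ∑ l, ν l = n + 1)
    (hν' : ∑ l, ν' l = n + 1) :
    SameExpression (coeffExpression n ν) (coeffExpression n ν') ↔
      ∃ σ : Equiv.Perm (Fin 3), ν' = ν ∘ σ := by
  have hcomp : ∀ (σ : Equiv.Perm (Fin 3)) (f : ℝ → ℝ) (α : Fin 3 → ℝ),
      residueCoeff f (α ∘ σ) ν = residueCoeff f α (ν ∘ σ.symm) := fun σ f α => by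
    rw [← residueCoeff_comp_perm f α (ν ∘ σ.symm) σ]
    congr 1
    funext l
    simp
  constructor
  · rintro ⟨σ, h⟩
    refine ⟨σ.symm, eq_of_coeffExpression_eq hν' (sum_comp_perm_eq hν _) ?_⟩
    funext f α
    rw [h]
    exact hcomp σ f.1 α.1
  · rintro ⟨σ, rfl⟩
    refine ⟨σ.symm, fun f α => ?_⟩
    exact (hcomp σ.symm f.1 α.1).symm

theorem coeffExpressions_eq (n : ℕ) :
    coeffExpressions n = coeffExpression n '' {ν | ∑ l, ν l = n + 1} := by
  ext g
  constructor
  · rintro ⟨i, rfl⟩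
    exact ⟨_, sum_occurrences i, rfl⟩
  · rintro ⟨ν, hν, rfl⟩
    obtain ⟨i, rfl⟩ := exists_occurrences_eq hν
    exact ⟨i, rfl⟩

theorem ncard_sum_eq (N : ℕ) :
    {ν : Fin 3 → ℕ | ∑ l, ν l = N}.ncard = (N + 1) * (N + 2) / 2 := by
  have himage : {ν : Fin 3 → ℕ | ∑ l, ν l = N} =
      (fun q : Σ _ : ℕ, ℕ => ![q.1, q.2, N - q.1 - q.2]) ''
        ((Finset.range (N + 1)).sigma fun a => Finset.range (N - a + 1)) := by
    ext ν
    simp only [Set.mem_ofPred_eq, Fin.sum_univ_three, Set.mem_image, Finset.mem_coe,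
      Finset.mem_sigma, Finset.mem_range]
    constructor
    · intro h
      refine ⟨⟨ν 0, ν 1⟩, ⟨by dsimp only; omega, by dsimp only; omega⟩, funext fun l => ?_⟩
      fin_cases l <;> simp
      omega
    · rintro ⟨⟨a, b⟩, ⟨h1, h2⟩, rfl⟩
      simp only [Matrix.cons_val]
      dsimp only at h1 h2
      omega
  rw [himage, Set.ncard_image_of_injective, Set.ncard_coe_finset, Finset.card_sigma]
  · simp only [Finset.card_range]
    have h : ∀ a ∈ Finset.range (N + 1), N - a + 1 = N + 1 - 1 - a + 1 := fun a _ => by simp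
    rw [Finset.sum_congr rfl h, Finset.sum_range_reflect fun a => a + 1]
    have := Finset.sum_range_succ' (fun a => a) (N + 1)
    rw [add_zero] at this
    rw [← this, Finset.sum_range_id, Nat.add_sub_cancel, mul_comm]
  · rintro ⟨a, b⟩ ⟨a', b'⟩ h
    have h0 := congrFun h 0
    have h1 := congrFun h 1
    simp only [Matrix.cons_val] at h0 h1
    rw [h0, h1]

theorem ncard_coeffExpressions (n : ℕ) :
    (coeffExpressions n).ncard = (n + 2) * (n + 3) / 2 := by
  rw [coeffExpressions_eq, Set.InjOn.ncard_image, ncard_sum_eq]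
  exact fun ν hν ν' hν' h => eq_of_coeffExpression_eq hν hν' h

/-- `(N - a) / 2 - a + 1` is the number of partitions of `N` into three parts whose least part
is `a`. -/
theorem sum_range_eq_round (N : ℕ) :
    ∑ a ∈ Finset.range (N / 3 + 1), ((N - a) / 2 - a + 1) = ((N + 3) ^ 2 + 4) / 12 := by
  induction N using Nat.strong_induction_on with
  | _ N ih =>
    rcases lt_or_ge N 3 with hN | hN
    · interval_cases N <;> rfl
    obtain ⟨m, rfl⟩ := Nat.exists_eq_add_of_le' hN
    have hterm : ∀ a ∈ Finset.range (m / 3 + 1),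
        (m + 3 - (a + 1)) / 2 - (a + 1) + 1 = (m - a) / 2 - a + 1 := by
      intro a ha
      have := Finset.mem_range.1 ha
      omega
    rw [show (m + 3) / 3 + 1 = m / 3 + 1 + 1 by omega, Finset.sum_range_succ',
      Finset.sum_congr rfl hterm, ih m (by omega)]
    have hr : m % 6 < 6 := Nat.mod_lt _ (by norm_num)
    have hm : m = 6 * (m / 6) + m % 6 := (Nat.div_add_mod m 6).symm
    generalize m / 6 = q at hm
    generalize m % 6 = r at hr hm
    subst hm
    interval_cases r <;> ring_nf <;> omega

theorem monotone_fin_three_iff {ν : Fin 3 → ℕ} : Monotone ν ↔ ν 0 ≤ ν 1 ∧ ν 1 ≤ ν 2 := by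
  rw [Fin.monotone_iff_le_succ, Fin.forall_fin_two]
  rfl

theorem ncard_monotone_sum_eq (N : ℕ) :
    {ν : Fin 3 → ℕ | Monotone ν ∧ ∑ l, ν l = N}.ncard = ((N + 3) ^ 2 + 4) / 12 := by
  have himage : {ν : Fin 3 → ℕ | Monotone ν ∧ ∑ l, ν l = N} =
      (fun q : Σ _ : ℕ, ℕ => ![q.1, q.1 + q.2, N - 2 * q.1 - q.2]) ''
        ((Finset.range (N / 3 + 1)).sigma fun a => Finset.range ((N - a) / 2 - a + 1)) := by
    ext ν
    simp only [Set.mem_ofPred_eq, monotone_fin_three_iff, Fin.sum_univ_three, Set.mem_image,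
      Finset.mem_coe, Finset.mem_sigma, Finset.mem_range]
    constructor
    · intro h
      refine ⟨⟨ν 0, ν 1 - ν 0⟩, ⟨by dsimp only; omega, by dsimp only; omega⟩, funext fun l => ?_⟩
      fin_cases l <;> simp <;> omega
    · rintro ⟨⟨a, b⟩, ⟨h1, h2⟩, rfl⟩
      simp only [Matrix.cons_val]
      dsimp only at h1 h2
      omega
  rw [himage, Set.ncard_image_of_injective, Set.ncard_coe_finset, Finset.card_sigma]
  · simp only [Finset.card_range, sum_range_eq_round]
  · rintro ⟨a, b⟩ ⟨a', b'⟩ h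
    have h0 := congrFun h 0
    have h1 := congrFun h 1
    simp only [Matrix.cons_val] at h0 h1
    obtain rfl : a = a' := h0
    obtain rfl : b = b' := by omega
    rfl

/-- Each class has exactly one representative with nondecreasing multiplicities. -/
theorem ncard_expressionClasses (n : ℕ) :
    {C : Set (Expression n) | ∃ g ∈ coeffExpressions n,
      C = {h ∈ coeffExpressions n | SameExpression g h}}.ncard = ((n + 4) ^ 2 + 4) / 12 := by
  have hsort : ∀ {ν : Fin 3 → ℕ} {σ : Equiv.Perm (Fin 3)}, Monotone ν → Monotone (ν ∘ σ) →
      ν = ν ∘ σ := fun {ν σ} h h' => by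
    have h1 := Tuple.comp_sort_eq_comp_iff_monotone.2 (show Monotone (ν ∘ Equiv.refl _) from h)
    have h2 := Tuple.comp_sort_eq_comp_iff_monotone.2 h'
    exact h1.trans h2.symm
  have himage : {C : Set (Expression n) | ∃ g ∈ coeffExpressions n,
      C = {h ∈ coeffExpressions n | SameExpression g h}} =
      (fun ν => {h ∈ coeffExpressions n | SameExpression (coeffExpression n ν) h}) ''
        {ν : Fin 3 → ℕ | Monotone ν ∧ ∑ l, ν l = n + 1} := by
    ext S
    rw [coeffExpressions_eq]
    constructor
    · rintro ⟨_, ⟨ν, hν, rfl⟩, rfl⟩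
      have hν' := sum_comp_perm_eq hν (Tuple.sort ν)
      refine ⟨ν ∘ Tuple.sort ν, ⟨Tuple.monotone_sort ν, hν'⟩, Set.ext fun h => ?_⟩
      refine and_congr_right ?_
      rintro ⟨μ, hμ, rfl⟩
      rw [sameExpression_iff hν' hμ, sameExpression_iff hν hμ]
      constructor
      · rintro ⟨σ, rfl⟩
        exact ⟨σ.trans (Tuple.sort ν), rfl⟩
      · rintro ⟨σ, rfl⟩
        refine ⟨σ.trans (Tuple.sort ν).symm, funext fun l => ?_⟩
        simp
    · rintro ⟨ν, ⟨-, hν⟩, rfl⟩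
      exact ⟨_, ⟨ν, hν, rfl⟩, rfl⟩
  rw [himage, Set.InjOn.ncard_image, ncard_monotone_sum_eq]
  rintro ν ⟨hm, hν⟩ ν' ⟨hm', hν'⟩ h
  have hmem : coeffExpression n ν' ∈
      {h ∈ coeffExpressions n | SameExpression (coeffExpression n ν') h} := by
    rw [coeffExpressions_eq]
    exact ⟨⟨ν', hν', rfl⟩, (sameExpression_iff hν' hν').2 ⟨Equiv.refl _, rfl⟩⟩
  replace hmem := h.superset hmem
  obtain ⟨σ, rfl⟩ := (sameExpression_iff hν hν').1 hmem.2
  exact hsort hm hm'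

end Counting

end TensorFunction

end

open TensorFunction in
theorem theorem1 {V : Type*} [NormedAddCommGroup V] [InnerProductSpace ℝ V] [FiniteDimensional ℝ V]
    [CompleteSpace V] (hV : Module.finrank ℝ V = 3) (n : ℕ) :
    -- the derivative and its coefficients
    (∀ (f : ℝ → ℝ) (d : ℕ) (α : Fin d → ℝ), d ≤ 3 → Function.Injective α →
      (∀ l, ContDiffAt ℝ n f (α l)) →
      ∃ c : (Fin (n + 1) → Fin d) → ℝ,
        -- the `n`-th derivative exists and is given by the coefficients, in its diagonal form
        -- (contraction with `X X … X`) and as a symmetric multilinear map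
        (∀ (A : SymTensor V) (P : Fin d → SymTensor V), IsSpectralDecomposition A α P →
          ContDiffAt ℝ n (tensorFun (V := V) f) A ∧
          (∀ X : SymTensor V,
            (1 / (n.factorial : ℝ)) •
                (iteratedFDeriv ℝ n (tensorFun (V := V) f) A (fun _ => X) : Lin V) =
              ∑ i : Fin (n + 1) → Fin d,
                c i • boxContract (fun s => (P (i s) : Lin V)) (fun _ => (X : Lin V))) ∧
          (∀ X : Fin n → SymTensor V,
            (iteratedFDeriv ℝ n (tensorFun (V := V) f) A X : Lin V) =
              ∑ σ : Equiv.Perm (Fin n), ∑ i : Fin (n + 1) → Fin d,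
                c i • boxContract (fun s => (P (i s) : Lin V)) (fun k => (X (σ k) : Lin V)))) ∧
        -- total symmetry
        (∀ (σ : Equiv.Perm (Fin (n + 1))) (i : Fin (n + 1) → Fin d), c (i ∘ σ) = c i) ∧
        -- the closed form, which depends on the multiplicities only
        (∀ i, c i = residueCoeff f α (occurrences i)) ∧
        -- the interpolating polynomial
        (∀ i, (∃! Q : Polynomial ℝ, Q.natDegree ≤ n ∧ Interpolates f α (occurrences i) Q) ∧
          ∀ Q : Polynomial ℝ, Q.natDegree ≤ n → Interpolates f α (occurrences i) Q →
            c i = Q.coeff n)) ∧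
    -- the number of distinct coefficients
    (coeffExpressions n).ncard = (n + 2) * (n + 3) / 2 ∧
    -- two coefficients have the same expression iff their multiplicities agree up to relabelling
    (∀ ν ν' : Fin 3 → ℕ, ∑ l, ν l = n + 1 → ∑ l, ν' l = n + 1 →
      (SameExpression (coeffExpression n ν) (coeffExpression n ν') ↔
        ∃ σ : Equiv.Perm (Fin 3), ν' = ν ∘ σ)) ∧
    -- the number of expressions
    {C : Set (Expression n) | ∃ g ∈ coeffExpressions n,
      C = {h ∈ coeffExpressions n | SameExpression g h}}.ncard = ((n + 4) ^ 2 + 4) / 12 := by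
  refine ⟨fun f d α _ hα hf => ⟨fun i => residueCoeff f α (occurrences i), ?_, ?_, fun _ => rfl,
    fun i => ⟨existsUnique_interpolates hα (sum_occurrences i) f, fun Q hQ hQf =>
      residueCoeff_eq_coeff_of_interpolates hα (sum_occurrences i) hf hQ hQf⟩⟩,
    ncard_coeffExpressions n, fun ν ν' hν hν' => sameExpression_iff hν hν',
    ncard_expressionClasses n⟩
  · intro A P hP
    obtain ⟨hdiff, hderiv⟩ := iteratedFDeriv_tensorFun hP hf
    refine ⟨hdiff, fun X => ?_, hderiv⟩
    -- all `n!` permutations contribute the same term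
    rw [hderiv, Finset.sum_const, Finset.card_univ, Fintype.card_perm, Fintype.card_fin,
      ← Nat.cast_smul_eq_nsmul ℝ, smul_smul,
      one_div_mul_cancel (Nat.cast_ne_zero.2 n.factorial_ne_zero), one_smul]
  · intro σ i
    simp only [occurrences_comp_perm]
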